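/- **Setting.** Datasets are finite multisets of records; two datasets are neighbouring if one is obtained from the other by adding one record. A randomized algorithm $M$ is $(\varepsilon,\delta)$-differentially private (DP) if $\Pr[M(D)\in E]\le e^{\varepsilon}\Pr[M(D')\in E]+\delta$ for all neighbouring $D,D'$ and all measurable $E$. If $\varepsilon=\varepsilon(o)$ is a function of the output $o$, $(\varepsilon(\cdot),\delta)$-DP means $\Pr[M(D)\in E]\le \int_E e^{\varepsilon(o)}\,dP_{M(D')}(o)+\delta$ for all such $D,D',E$. **Algorithm (propose-test hyperparameter tuning with doubling step).** Inputs: a finite list $S=(S_1,\dots,S_n)$ of hyperparameters; $\varepsilon,\varepsilon_0>0$; $\delta\in(0,1)$; a training set $D$; a validation set $V$; a number of parts $k\ge1$; a granularity $g\in(0,1)$; a utility lower bound $u_0\in[0,1)$; an arbitrary randomized procedure $\mathrm{Train}$; an accuracy function $\mathrm{Acc}$ with values in $[0,1]$; a randomized procedure $\mathrm{PrivateTrain}(\cdot,h)$ that is $(\varepsilon,\delta)$-DP for each $h$ (each hyperparameter, and also $h=\emptyset$). 1. Partition $D$ into $D_1,\dots,D_k$ by a rule for which adding one record to $D$ adds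 that record to one part and leaves the other parts unchanged. For every $s$ let $u_s=\frac1k\sum_{i=1}^k\mathrm{Acc}(V,\mathrm{Train}(D_i,S_s))$, all runs being independent. 2. Set $s^*=\emptyset$, $u=u_0$, $\mathit{step}=1$. While $\mathit{step}\ne0$ and $u<1$: draw fresh independent noises $\xi\sim\mathrm{Lap}(2/(k\varepsilon_0))$ and $\gamma_1,\dots,\gamma_n\sim\mathrm{Lap}(4/(k\varepsilon_0))$; if some $s$ satisfies $u_s+\gamma_s\ge u+\mathit{step}\cdot g+\xi$, let $s$ be the first such index and set $s^*\leftarrow s$, $u\leftarrow u+\mathit{step}\cdot g$, $\mathit{step}\leftarrow2\,\mathit{step}$; otherwise set $\mathit{step}\leftarrow\lfloor\mathit{step}/2\rfloor$. 3. Let $u^*$ be the final value of $u$. Output $s^*$ and $\theta^*=\mathrm{PrivateTrain}(D,S_{s^*})$, with $S_\emptyset=\emptyset$. **Theorem.** There are universal constants $C>0$ and $c\in\mathbb N$ such that, for all inputs as above and every $\delta'\in(0,1)$, with $$B(u)=C\,\sqrt{N_u+1}\,\Bigl(1+\log\frac{N_u+1}{\delta'}\Bigr)^{c}\,\varepsilon_0=\tilde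 O\!\left(\sqrt{N_u+1}\right)\varepsilon_0,\qquad N_u=\frac{u-u_0}{g},$$ the following hold with respect to the training set. (i) The algorithm, even if it also releases $u^*$, is $(\varepsilon+B(u^*),\,\delta+\delta')$-DP, where $u^*$ is the realized final accumulated utility. (ii) If $U$ is a real number such that $u^*\le U$ almost surely on every training set, then the algorithm, with output $(s^*,\theta^*)$, is $(\varepsilon+B(U),\,\delta+\delta')$-DP. -/

import Mathlib

open MeasureTheory ProbabilityTheory

noncomputable section

/-! ### Differential privacy for algorithms on finite datasets (multisets of records) -/

/-- Neighbouring datasets: one is obtained from the other by adding a single record. -/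
def Neighbouring {X : Type*} (D D' : Multiset X) : Prop :=
  ∃ x, D' = x ::ₘ D ∨ D = x ::ₘ D'

/-- `(ε, δ)`-differential privacy of a randomized algorithm, given by its output laws. -/
def IsDP {X Ω : Type*} [MeasurableSpace Ω] (M : Multiset X → Measure Ω) (ε δ : ℝ) : Prop :=
  ∀ D D', Neighbouring D D' → ∀ E, MeasurableSet E →
    M D E ≤ ENNReal.ofReal (Real.exp ε) * M D' E + ENNReal.ofReal δ

/-- `(ε, δ)`-differential privacy in which the parameter `ε` is a function of the realized
output (for a constant function this is `IsDP`). -/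
def IsOutputDP {X Ω : Type*} [MeasurableSpace Ω] (M : Multiset X → Measure Ω) (ε : Ω → ℝ)
    (δ : ℝ) : Prop :=
  ∀ D D', Neighbouring D D' → ∀ E, MeasurableSet E →
    M D E ≤ (∫⁻ o in E, ENNReal.ofReal (Real.exp (ε o)) ∂(M D')) + ENNReal.ofReal δ

/-! ### Laplace noise -/

/-- The centred Laplace distribution with scale `b`: density `exp (-|x| / b) / (2 b)` for
`0 < b`, and (by convention) the point mass at `0` otherwise. -/
def laplace (b : ℝ) : Measure ℝ :=
  if 0 < b then
    volume.withDensity fun x => ENNReal.ofReal (Real.exp (-|x| / b) / (2 * b))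
  else Measure.dirac 0

instance instIsProbabilityMeasureLaplace (b : ℝ) : IsProbabilityMeasure (laplace b) := by
  unfold laplace
  split_ifs with hb
  · have hint : ∫ x : ℝ, Real.exp (-|x| / b) / (2 * b) = 1 := by
      rw [integral_comp_abs (f := fun x => Real.exp (-x / b) / (2 * b)), integral_div]
      have h : ∫ x in Set.Ioi (0 : ℝ), Real.exp (-x / b) = b := by
        have h1 := integral_comp_mul_left_Ioi (fun y => Real.exp (-y)) 0 (inv_pos.2 hb)
        simp only [mul_zero, integral_exp_neg_Ioi_zero, inv_inv, smul_eq_mul, mul_one] at h1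
        have h2 : ∀ x : ℝ, -x / b = -(b⁻¹ * x) := fun x => by ring
        simp only [h2]
        exact h1
      rw [h]
      field_simp
    have hi : Integrable (fun x : ℝ => Real.exp (-|x| / b) / (2 * b)) :=
      Integrable.of_integral_ne_zero (by rw [hint]; exact one_ne_zero)
    constructor
    rw [withDensity_apply _ MeasurableSet.univ, Measure.restrict_univ,
      ← ofReal_integral_eq_lintegral_ofReal hi (ae_of_all _ fun x => by positivity), hint,
      ENNReal.ofReal_one]
  · infer_instance

/-! ### The input of the tuning algorithm -/

/-- A rule that partitions every dataset into `k` parts, each record being put into exactly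
one part: adding one record enlarges one part by that record and leaves the others unchanged. -/
structure Splitting (X : Type*) (k : ℕ) where
  part : Multiset X → Fin k → Multiset X
  sum_part : ∀ D, ∑ i, part D i = D
  part_cons : ∀ x D, ∃ i,
    part (x ::ₘ D) = Function.update (part D) i (x ::ₘ part D i)

/-- Everything the tuning algorithm takes as input besides the training set: training records
lie in `X`, validation records in `Y`, hyperparameters in `H`, model parameters in `Θ`. -/
structure TuningSetup (X Y H Θ : Type*) [MeasurableSpace Θ] where
  /-- the number `|S|` of candidates -/
  n : ℕ
  /-- the list of candidates -/
  cand : Fin n → H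
  /-- the number of partitions -/
  k : ℕ
  k_pos : 0 < k
  split : Splitting X k
  /-- the (private or not private) randomized training procedure used in the search -/
  train : Multiset X → H → ProbabilityMeasure Θ
  /-- the private training procedure that is run at the end, on the selected hyperparameter
  (or on `none` if no candidate was ever selected) -/
  privateTrain : Multiset X → Option H → ProbabilityMeasure Θ
  validSet : Multiset Y
  acc : Multiset Y → Θ → ℝ
  measurable_acc : Measurable (acc validSet)
  acc_mem : ∀ θ, acc validSet θ ∈ Set.Icc (0 : ℝ) 1
  /-- the utility granularity -/
  g : ℝ
  g_mem : g ∈ Set.Ioo (0 : ℝ) 1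
  /-- the utility lower bound -/
  u₀ : ℝ
  u₀_mem : u₀ ∈ Set.Ico (0 : ℝ) 1
  /-- the privacy parameter of one iteration -/
  ε₀ : ℝ
  ε₀_pos : 0 < ε₀

/-- The value of the variables of the main loop. -/
structure LoopState (n : ℕ) where
  /-- the current `s*` -/
  best : Option (Fin n)
  /-- the accumulated utility -/
  u : ℝ
  step : ℕ

instance instMeasurableSpaceCandidate (n : ℕ) : MeasurableSpace (Option (Fin n)) := ⊤

instance instDiscreteCandidate (n : ℕ) : DiscreteMeasurableSpace (Option (Fin n)) := ⟨fun _ => trivial⟩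

namespace TuningSetup

variable {X Y H Θ : Type*} [MeasurableSpace Θ] (P : TuningSetup X Y H Θ)

/-! ### Subsample-and-aggregate utilities -/

/-- The joint law of the models trained for each candidate on each part (independent runs). -/
def runs (D : Multiset X) : Measure (Fin P.n → Fin P.k → Θ) :=
  Measure.pi fun s => Measure.pi fun i => (P.train (P.split.part D i) (P.cand s) : Measure Θ)

/-- The average accuracy `u_s` of the models trained for candidate `s`. -/
def util (θ : Fin P.n → Fin P.k → Θ) (s : Fin P.n) : ℝ :=
  (1 / (P.k : ℝ)) * ∑ i, P.acc P.validSet (θ s i)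

/-! ### The main loop -/

/-- The noise used in one iteration: the threshold noise and the noises `γ_s`. -/
abbrev Noise : Type := ℝ × (Fin P.n → ℝ)

def noiseLaw : Measure P.Noise :=
  (laplace (2 / (P.k * P.ε₀))).prod (Measure.pi fun _ => laplace (4 / (P.k * P.ε₀)))

instance isProbabilityMeasure_noiseLaw : IsProbabilityMeasure P.noiseLaw := by unfold noiseLaw; infer_instance

def init : LoopState P.n := ⟨none, P.u₀, 1⟩

/-- The loop is left when `step = 0` or `u ≥ 1`. -/
def Halted (σ : LoopState P.n) : Prop := σ.step = 0 ∨ 1 ≤ σ.u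

open Classical in
/-- The first candidate whose noisy utility reaches the noisy threshold, if there is one. -/
def accepted (util : Fin P.n → ℝ) (ω : P.Noise) (σ : LoopState P.n) : Option (Fin P.n) :=
  (List.finRange P.n).find? fun s => σ.u + σ.step * P.g + ω.1 ≤ util s + ω.2 s

/-- One iteration of the loop. -/
def iterate (util : Fin P.n → ℝ) (ω : P.Noise) (σ : LoopState P.n) : LoopState P.n :=
  match P.accepted util ω σ with
  | some s => ⟨some s, σ.u + σ.step * P.g, σ.step * 2⟩
  | none => ⟨σ.best, σ.u, σ.step / 2⟩

open Classical in
/-- The variables after `t` iterations (constant once the loop has been left). -/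
def traj (util : Fin P.n → ℝ) (ω : ℕ → P.Noise) : ℕ → LoopState P.n
  | 0 => P.init
  | t + 1 =>
    if P.Halted (traj util ω t) then traj util ω t else P.iterate util (ω t) (traj util ω t)

/-- The number of iterations. -/
def count (util : Fin P.n → ℝ) (ω : ℕ → P.Noise) : ℕ := sInf {t | P.Halted (P.traj util ω t)}

/-- The variables when the loop has been left. -/
def final (util : Fin P.n → ℝ) (ω : ℕ → P.Noise) : LoopState P.n :=
  P.traj util ω (P.count util ω)

/-- Along every run the loop is left after finitely many iterations. -/
theorem exists_halted (util : Fin P.n → ℝ) (ω : ℕ → P.Noise) :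
    ∃ t, P.Halted (P.traj util ω t) := by
  by_contra hcon
  push Not at hcon
  have hg := P.g_mem.1
  have key : ∀ t, ∃ a f : ℕ, a + f = t ∧ P.u₀ + a * P.g ≤ (P.traj util ω t).u ∧
      (P.traj util ω t).step * 2 ^ f ≤ 2 ^ a := by
    intro t
    induction t with
    | zero => exact ⟨0, 0, rfl, by simp [traj, init], by simp [traj, init]⟩
    | succ t ih =>
      obtain ⟨a, f, hat, hu, hs⟩ := ih
      have hn := hcon t
      have h1 : 1 ≤ (P.traj util ω t).step := by
        by_contra h
        exact hn (Or.inl (by omega))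
      have h1' : (1 : ℝ) ≤ (P.traj util ω t).step := by exact_mod_cast h1
      simp only [traj, if_neg hn, iterate]
      split
      · refine ⟨a + 1, f, by omega, ?_, ?_⟩
        · push_cast
          nlinarith
        · rw [pow_succ]
          nlinarith
      · refine ⟨a, f + 1, by omega, hu, ?_⟩
        refine le_trans ?_ hs
        rw [pow_succ, mul_comm (2 ^ f) 2, ← mul_assoc]
        exact Nat.mul_le_mul_right _ (Nat.div_mul_le_self _ 2)
  obtain ⟨m, hm⟩ := exists_nat_gt ((1 - P.u₀) / P.g)
  obtain ⟨a, f, hat, hu, hs⟩ := key (2 * m)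
  have hn := hcon (2 * m)
  have h1 : 1 ≤ (P.traj util ω (2 * m)).step := by
    by_contra h
    exact hn (Or.inl (by omega))
  have hu1 : (P.traj util ω (2 * m)).u < 1 := by
    by_contra h
    exact hn (Or.inr (not_lt.1 h))
  have hfa : f ≤ a := by
    refine (Nat.pow_le_pow_iff_right (a := 2) (by norm_num)).1 (le_trans ?_ hs)
    exact Nat.le_mul_of_pos_left _ h1
  have hma : (m : ℝ) ≤ a := by exact_mod_cast (by omega : m ≤ a)
  rw [div_lt_iff₀ hg] at hm
  nlinarith

theorem measurable_accepted {Ω : Type*} [MeasurableSpace Ω] {v : Ω → Fin P.n → ℝ}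
    {w : Ω → P.Noise} {σ : Ω → LoopState P.n} (hv : Measurable v) (hw : Measurable w)
    (hu : Measurable fun r => (σ r).u) (hs : Measurable fun r => (σ r).step) :
    Measurable fun r => P.accepted (v r) (w r) (σ r) := by
  classical
  unfold accepted
  generalize List.finRange P.n = l
  induction l with
  | nil => simp
  | cons a l ih =>
    have hset : MeasurableSet
        {r | (σ r).u + (σ r).step * P.g + (w r).1 ≤ v r a + (w r).2 a} := by
      have hs' : Measurable fun r => ((σ r).step : ℝ) := measurable_from_nat.comp hs
      exact measurableSet_le (by fun_prop) (by fun_prop)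
    have : Measurable fun r =>
        if (σ r).u + (σ r).step * P.g + (w r).1 ≤ v r a + (w r).2 a then some a
        else l.find? fun s => (σ r).u + (σ r).step * P.g + (w r).1 ≤ v r s + (w r).2 s :=
      Measurable.ite hset (measurable_const (a := some a)) ih
    convert this using 1
    ext1 r
    by_cases h : (σ r).u + (σ r).step * P.g + (w r).1 ≤ v r a + (w r).2 a <;>
      simp [h]

theorem measurable_traj (t : ℕ) :
    Measurable fun r : (Fin P.n → ℝ) × (ℕ → P.Noise) =>
      ((P.traj r.1 r.2 t).best, (P.traj r.1 r.2 t).u, (P.traj r.1 r.2 t).step) := by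
  classical
  induction t with
  | zero => simp only [traj]; exact measurable_const
  | succ t ih =>
    have hb := measurable_fst.comp ih
    have hu := measurable_fst.comp (measurable_snd.comp ih)
    have hs := measurable_snd.comp (measurable_snd.comp ih)
    simp only [Function.comp_def] at hb hu hs
    have hs' : Measurable fun r : (Fin P.n → ℝ) × (ℕ → P.Noise) =>
      ((P.traj r.1 r.2 t).step : ℝ) := measurable_from_nat.comp hs
    have hacc := P.measurable_accepted (v := fun r : (Fin P.n → ℝ) × (ℕ → P.Noise) => r.1)
      (w := fun r => r.2 t) measurable_fst (by fun_prop) hu hs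
    have hh : MeasurableSet {r : (Fin P.n → ℝ) × (ℕ → P.Noise) |
        P.Halted (P.traj r.1 r.2 t)} :=
      (measurableSet_eq_fun hs measurable_const).union (measurableSet_le measurable_const hu)
    have hnone : MeasurableSet {r : (Fin P.n → ℝ) × (ℕ → P.Noise) |
        P.accepted r.1 (r.2 t) (P.traj r.1 r.2 t) = none} :=
      hacc (MeasurableSet.of_discrete (s := {none}))
    have : Measurable fun r : (Fin P.n → ℝ) × (ℕ → P.Noise) =>
        if P.Halted (P.traj r.1 r.2 t) then
          ((P.traj r.1 r.2 t).best, (P.traj r.1 r.2 t).u, (P.traj r.1 r.2 t).step)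
        else if P.accepted r.1 (r.2 t) (P.traj r.1 r.2 t) = none then
          ((P.traj r.1 r.2 t).best, (P.traj r.1 r.2 t).u, (P.traj r.1 r.2 t).step / 2)
        else (P.accepted r.1 (r.2 t) (P.traj r.1 r.2 t),
          (P.traj r.1 r.2 t).u + (P.traj r.1 r.2 t).step * P.g,
          (P.traj r.1 r.2 t).step * 2) := Measurable.ite hh ih (Measurable.ite hnone
      (hb.prodMk (hu.prodMk ((measurable_from_nat (f := fun m => m / 2)).comp hs)))
      (hacc.prodMk ((hu.add (hs'.mul_const P.g)).prodMk
        ((measurable_from_nat (f := fun m => m * 2)).comp hs))))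
    convert this using 1
    ext1 r
    by_cases h : P.Halted (P.traj r.1 r.2 t)
    · simp [traj, h]
    · rcases h' : P.accepted r.1 (r.2 t) (P.traj r.1 r.2 t) with _ | s <;>
        simp [traj, h, iterate, h']

theorem measurable_final :
    Measurable fun r : (Fin P.n → ℝ) × (ℕ → P.Noise) =>
      ((P.final r.1 r.2).best, (P.final r.1 r.2).u) := by
  classical
  have hh : ∀ t, MeasurableSet {r : (Fin P.n → ℝ) × (ℕ → P.Noise) |
      P.Halted (P.traj r.1 r.2 t)} := fun t =>
    (measurableSet_eq_fun (measurable_snd.comp (measurable_snd.comp (P.measurable_traj t)))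
      measurable_const).union (measurableSet_le measurable_const
        (measurable_fst.comp (measurable_snd.comp (P.measurable_traj t))))
  have hc : Measurable fun r : (Fin P.n → ℝ) × (ℕ → P.Noise) => P.count r.1 r.2 := by
    have := measurable_find (fun r : (Fin P.n → ℝ) × (ℕ → P.Noise) =>
      P.exists_halted r.1 r.2) hh
    convert this using 1
    ext1 r
    exact Nat.sInf_def (P.exists_halted r.1 r.2)
  have h2 : Measurable fun q : ((Fin P.n → ℝ) × (ℕ → P.Noise)) × ℕ =>
      ((P.traj q.1.1 q.1.2 q.2).best, (P.traj q.1.1 q.1.2 q.2).u) :=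
    measurable_from_prod_countable_left fun t =>
      (measurable_fst.comp (P.measurable_traj t)).prodMk
        (measurable_fst.comp (measurable_snd.comp (P.measurable_traj t)))
  exact h2.comp (measurable_id.prodMk hc)

theorem measurable_util : Measurable P.util := by
  refine measurable_pi_lambda _ fun s => ?_
  have := P.measurable_acc
  unfold util
  fun_prop

/-! ### The output of the algorithm -/

/-- The joint law of the selected candidate `s*` and of the final accumulated utility `u*`. -/
def searchLaw (D : Multiset X) : Measure (Option (Fin P.n) × ℝ) :=
  ((P.runs D).prod (Measure.infinitePi fun _ : ℕ => P.noiseLaw)).map fun r =>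
    ((P.final (P.util r.1) r.2).best, (P.final (P.util r.1) r.2).u)

/-- The final private training run, given `s*` (and `u*`, which it does not use). -/
def finalRun (D : Multiset X) : Kernel (Option (Fin P.n) × ℝ) Θ :=
  (Kernel.ofFunOfCountable fun s => (P.privateTrain D (s.map P.cand) : Measure Θ)).comap
    Prod.fst measurable_fst

/-- The joint law of `((s*, u*), θ*)`. -/
def fullLaw (D : Multiset X) : Measure ((Option (Fin P.n) × ℝ) × Θ) :=
  P.searchLaw D ⊗ₘ P.finalRun D

instance isProbabilityMeasure_runs (D : Multiset X) : IsProbabilityMeasure (P.runs D) := by unfold runs; infer_instance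

instance isProbabilityMeasure_searchLaw (D : Multiset X) : IsProbabilityMeasure (P.searchLaw D) := by
  unfold searchLaw
  refine Measure.isProbabilityMeasure_map (Measurable.aemeasurable ?_)
  exact P.measurable_final.comp
    ((P.measurable_util.comp measurable_fst).prodMk measurable_snd)

instance isMarkovKernel_finalRun (D : Multiset X) : IsMarkovKernel (P.finalRun D) := by
  constructor
  intro a
  change IsProbabilityMeasure (P.privateTrain D (a.1.map P.cand) : Measure Θ)
  infer_instance

instance isProbabilityMeasure_fullLaw (D : Multiset X) : IsProbabilityMeasure (P.fullLaw D) := by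
  unfold fullLaw; infer_instance

/-- The law of the output `(s*, θ*)` of the algorithm. -/
def outputLaw (D : Multiset X) : Measure (Option (Fin P.n) × Θ) :=
  (P.fullLaw D).map fun o => (o.1.1, o.2)

/-- The additional privacy loss, as a function of a value `u` of the accumulated utility:
`√(N + 1)` with `N = (u - u₀) / g`, times a polylogarithmic factor in `N + 1` and `1 / δ'`,
times `ε₀`. -/
def extraLoss (C : ℝ) (c : ℕ) (δ' u : ℝ) : ℝ :=
  C * Real.sqrt ((u - P.u₀) / P.g + 1)
    * (1 + Real.log (((u - P.u₀) / P.g + 1) / δ')) ^ c * P.ε₀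

end TuningSetup

end

/-! One iteration is a noisy threshold test. If all utilities move by at most `1 / k`, its outcome
(the first accepted candidate, or none) is `ε₀`-private however many candidates there are
(`acceptLaw_le`). Training may be arbitrary: runs on neighbouring datasets are coupled to agree on
every unchanged part, so the utilities do move by at most `1 / k` (`lintegral_runs_le`). Pure
composition then costs `exp (ε₀ * count)`, where the number `count` of iterations is random and is
carried along as part of the state (`chainValue_composition`).

It remains to see that the search is short. The acceptance probability decreases with the queried
value, so it has a median, and the doubling and halving step is a noisy binary search for it.
`searchPotential` is polynomial in `H` and drops by `1` on average at each iteration below position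
`2 ^ H` (`searchPotential_step`). Exponentiating it gives a supermartingale for each `H`. Their sum
dominates the indicator of a run that is too long for its own final position, and is at most `2⁻ᵈ`
at the start (`chainValue_iterationBound_lt`). So `count` is polylogarithmic in `N + 1` and `1 / δ'`
outside an event of probability `δ'`. The loss obtained is polylogarithmic times `ε₀`; the factor
`√(N + 1) ≥ 1` is slack.

The final training is composed by testing the search against its truncated acceptance probability
(`isOutputDP_fullLaw`). A uniform bound on the final utility then gives the second claim by
monotonicity of the loss. -/

noncomputable section

/-! ### Finite-horizon values of a discrete chain with absorbing states -/

section Chain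

open scoped ENNReal

variable {S O : Type*} [Fintype O]

open Classical in
/-- The expected reward `ψ` after at most `t` steps of a chain that moves from `x` to `next o x`
with weight `q x o` until it is absorbed in `halt`. -/
def chainValue (halt : S → Prop) (next : O → S → S) (q : S → O → ℝ≥0∞) (ψ : S → ℝ≥0∞) :
    ℕ → S → ℝ≥0∞
  | 0, x => ψ x
  | t + 1, x =>
    if halt x then ψ x else ∑ o, q x o * chainValue halt next q ψ t (next o x)

variable {halt : S → Prop} {next : O → S → S} {q q' : S → O → ℝ≥0∞} {ψ φ W : S → ℝ≥0∞}

theorem chainValue_mono {I : S → Prop} (hI : ∀ x o, I x → ¬halt x → I (next o x))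
    (h : ∀ x, I x → ψ x ≤ φ x) (t : ℕ) {x : S} (hx : I x) :
    chainValue halt next q ψ t x ≤ chainValue halt next q φ t x := by
  induction t generalizing x with
  | zero => exact h x hx
  | succ t ih =>
    simp only [chainValue]
    split_ifs with hh
    · exact h x hx
    · exact Finset.sum_le_sum fun o _ => mul_le_mul_right (ih (hI x o hx hh)) _

theorem chainValue_add (t : ℕ) (x : S) :
    chainValue halt next q (fun y => ψ y + φ y) t x =
      chainValue halt next q ψ t x + chainValue halt next q φ t x := by
  induction t generalizing x with
  | zero => rfl
  | succ t ih =>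
    simp only [chainValue]
    split_ifs with hh
    · rfl
    · simp only [ih, mul_add, Finset.sum_add_distrib]

/-- Optional stopping: a supermartingale above the reward bounds the expected reward. The invariant
`I` restricts the check to states that can actually occur. -/
theorem chainValue_le_of_superharmonic {I : S → Prop}
    (hI : ∀ x o, I x → ¬halt x → I (next o x)) (h : ∀ x, I x → ψ x ≤ W x)
    (hW : ∀ x, I x → ¬halt x → ∑ o, q x o * W (next o x) ≤ W x) (t : ℕ) {x : S} (hx : I x) :
    chainValue halt next q ψ t x ≤ W x := by
  induction t generalizing x with
  | zero => exact h x hx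
  | succ t ih =>
    simp only [chainValue]
    split_ifs with hh
    · exact h x hx
    · exact (Finset.sum_le_sum fun o _ => mul_le_mul_right (ih (hI x o hx hh)) _).trans
        (hW x hx hh)

/-- Pure composition: if each step loses a factor at most `e`, then a chain that counts its steps
loses at most `e ^ count`. -/
theorem chainValue_composition {e : ℝ≥0∞} (hq : ∀ x o, q x o ≤ e * q' x o) (cnt : S → ℕ)
    (hcnt : ∀ x o, cnt (next o x) = cnt x + 1) (t : ℕ) (x : S) :
    e ^ cnt x * chainValue halt next q ψ t x ≤
      chainValue halt next q' (fun y => e ^ cnt y * ψ y) t x := by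
  induction t generalizing x with
  | zero => exact le_rfl
  | succ t ih =>
    simp only [chainValue]
    split_ifs with hh
    · exact le_rfl
    · rw [Finset.mul_sum]
      -- The weight `e ^ cnt` stays inside the expectation, so the number of steps may depend on the
      -- run.
      refine Finset.sum_le_sum fun o _ => ?_
      calc e ^ cnt x * (q x o * chainValue halt next q ψ t (next o x))
          ≤ e ^ cnt x * (e * q' x o * chainValue halt next q ψ t (next o x)) := by
            gcongr; exact hq x o
        _ = q' x o * (e ^ cnt (next o x) * chainValue halt next q ψ t (next o x)) := by
            rw [hcnt, pow_succ]; ring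
        _ ≤ _ := by gcongr; exact ih _

end Chain

/-! ### A potential for noisy exponential search

The search is at position `N`, its step is `2 ^ b / 2`, and it stops when the step is `0`.
A query `x` is accepted with a probability that is at least `1 / 2` for `x ≤ a` and at most `1 / 2`
for `x > a`. Below the level `2 ^ H`, each iteration lowers the potential by `1` on average. -/

/-- The potential of position `N` and step `2 ^ b / 2`. -/
def searchPotential (H a N b : ℕ) : ℝ :=
  if 2 ^ H ≤ N then 0
  else if a < N then 1 + b * (2 * H + 4 - b)
  else (H + 2) ^ 2 + ((H + 2) ^ 2 + (H + 2)) * (a - N).size +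
    if b ≤ (a - N).size then ((H + 2) ^ 2 - (b - 1) ^ 2 : ℝ) else (H + 2) ^ 2 + b

theorem searchPotential_of_le {H a N b : ℕ} (h : 2 ^ H ≤ N) : searchPotential H a N b = 0 :=
  if_pos h

theorem searchPotential_beyond {H a N b : ℕ} (h : N < 2 ^ H) (ha : a < N) :
    searchPotential H a N b = 1 + b * (2 * H + 4 - b) := by
  rw [searchPotential, if_neg h.not_ge, if_pos ha]

theorem searchPotential_before {H a N b : ℕ} (h : N < 2 ^ H) (ha : N ≤ a) :
    searchPotential H a N b = (H + 2) ^ 2 + ((H + 2) ^ 2 + (H + 2)) * (a - N).size +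
      if b ≤ (a - N).size then ((H + 2) ^ 2 - (b - 1) ^ 2 : ℝ) else (H + 2) ^ 2 + b := by
  rw [searchPotential, if_neg h.not_ge, if_neg ha.not_gt]

theorem one_le_searchPotential {H a N b : ℕ} (h : N < 2 ^ H) (hb : b ≤ H + 1) :
    1 ≤ searchPotential H a N b := by
  have hb' : (b : ℝ) ≤ H + 1 := by exact_mod_cast hb
  have hb0 : (0 : ℝ) ≤ b := b.cast_nonneg
  have hH : (0 : ℝ) ≤ H := H.cast_nonneg
  rcases lt_or_ge a N with ha | ha
  · rw [searchPotential_beyond h ha]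
    have : (0 : ℝ) ≤ b * (2 * H + 4 - b) := mul_nonneg hb0 (by linarith)
    linarith
  · rw [searchPotential_before h ha]
    have h1 : (0 : ℝ) ≤ ((H + 2) ^ 2 + (H + 2)) * (a - N).size := by positivity
    split_ifs <;> nlinarith

theorem searchPotential_nonneg {H a N b : ℕ} (hb : N < 2 ^ H → b ≤ H + 1) :
    0 ≤ searchPotential H a N b := by
  rcases lt_or_ge N (2 ^ H) with h | h
  · linarith [one_le_searchPotential (a := a) h (hb h)]
  · rw [searchPotential_of_le h]

theorem size_sub_le {H a N : ℕ} (ha : a ≤ 2 ^ H) : (a - N).size ≤ H + 1 :=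
  Nat.size_le.2 (by rw [pow_succ]; have := Nat.two_pow_pos H; omega)

/-- Here `b * (2 * H + 4 - b) = (H + 2) ^ 2 - (H + 2 - b) ^ 2`, and the last square is at least `1`.
-/
theorem beyond_le_sq {H b : ℕ} (hb : b ≤ H + 1) :
    (1 + b * (2 * H + 4 - b) : ℝ) ≤ (H + 2) ^ 2 := by
  have hb' : (b : ℝ) ≤ H + 1 := by exact_mod_cast hb
  nlinarith

theorem searchPotential_le {H a N b : ℕ} (ha : a ≤ 2 ^ H) (hb : b ≤ H + 1) :
    searchPotential H a N b ≤ 3 * (H + 2) ^ 3 := by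
  have hb' : (b : ℝ) ≤ H + 1 := by exact_mod_cast hb
  have hH : (0 : ℝ) ≤ H := H.cast_nonneg
  rcases le_or_gt (2 ^ H) N with h | h
  · rw [searchPotential_of_le h]; positivity
  · rcases lt_or_ge a N with haN | haN
    · rw [searchPotential_beyond h haN]
      refine (beyond_le_sq hb).trans ?_
      nlinarith [sq_nonneg ((H : ℝ) + 2)]
    · rw [searchPotential_before h haN]
      have hs : ((a - N).size : ℝ) ≤ H + 1 := by exact_mod_cast size_sub_le ha
      have h1 : (((H : ℝ) + 2) ^ 2 + (H + 2)) * (a - N).size ≤ ((H + 2) ^ 2 + (H + 2)) * (H + 1) := by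
        gcongr
      have h2 : (if b ≤ (a - N).size then ((H + 2) ^ 2 - (b - 1) ^ 2 : ℝ) else (H + 2) ^ 2 + b) ≤
          (H + 2) ^ 2 + (H + 2) := by
        split_ifs <;> nlinarith
      nlinarith [pow_nonneg hH 3, sq_nonneg (H : ℝ)]

/-- There are three regimes. Beyond the median, `b` is a walk with no upward drift, and the concave
increasing `b * (2 * H + 4 - b)` loses `1` under a fair step. Before the median with a short step,
`b` has no downward drift, and the concave `-(b - 1) ^ 2` loses `1`; centring it at `1` makes `b =
0` harmless. Before the median with a step that overshoots, a rejection lowers the linear term by at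
least `1`, and an acceptance crosses the median for good. Changes of regime are paid for by the
coefficient of the bit length of the gap `a - N`, or by the base term `(H + 2) ^ 2`. -/
theorem searchPotential_step {H a N b : ℕ} {p : ℝ} (hN : N < 2 ^ H)
    (hb1 : 1 ≤ b) (hb : b ≤ H + 1) (hp0 : 0 ≤ p) (hp1 : p ≤ 1)
    (hlow : N + 2 ^ (b - 1) ≤ a → 1 / 2 ≤ p)
    (hhigh : a < N + 2 ^ (b - 1) → N + 2 ^ (b - 1) < 2 ^ H → p ≤ 1 / 2) :
    p * searchPotential H a (N + 2 ^ (b - 1)) (b + 1) + (1 - p) * searchPotential H a N (b - 1) ≤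
      searchPotential H a N b - 1 := by
  obtain ⟨h, rfl⟩ : ∃ h, b = h + 1 := ⟨b - 1, by omega⟩
  simp only [Nat.add_sub_cancel] at *
  have hh : (h : ℝ) ≤ H := by exact_mod_cast (by omega : h ≤ H)
  have hh0 : (0 : ℝ) ≤ h := h.cast_nonneg
  have hpos := Nat.two_pow_pos h
  have hlt : N + 2 ^ h < 2 ^ H → (h : ℝ) + 1 ≤ H := fun hk => by
    have : h < H := (Nat.pow_lt_pow_iff_right (a := 2) (by norm_num)).1 (by omega)
    exact_mod_cast this
  rcases lt_or_ge a N with ha | ha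
  · -- beyond the median
    rw [searchPotential_beyond hN ha, searchPotential_beyond hN ha]
    push_cast
    -- If acceptance leaves the range, the potential becomes `0`, and no bound on `p` by `1 / 2` is
    -- needed.
    rcases le_or_gt (2 ^ H) (N + 2 ^ h) with hk | hk
    · rw [searchPotential_of_le hk]
      have : (0 : ℝ) ≤ 1 + h * (2 * H + 4 - h) := by nlinarith
      nlinarith
    · rw [searchPotential_beyond hk (by omega)]
      have hp := hhigh (by omega) hk
      have := hlt hk
      push_cast
      nlinarith
  · have hrej0 : searchPotential H a N h =
        (H + 2) ^ 2 + ((H + 2) ^ 2 + (H + 2)) * (a - N).size +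
          if h ≤ (a - N).size then ((H + 2) ^ 2 - (h - 1) ^ 2 : ℝ) else (H + 2) ^ 2 + h :=
      searchPotential_before hN ha
    have hcur := searchPotential_before (b := h + 1) hN ha
    rcases le_or_gt (N + 2 ^ h) a with hle | hgt
    · have hp := hlow hle
      have hL : h < (a - N).size := Nat.lt_size.2 (by omega)
      rw [if_pos (by omega)] at hrej0 hcur
      set L : ℕ := (a - N).size with hLdef
      have hacc : searchPotential H a (N + 2 ^ h) (h + 1 + 1) ≤
          (H + 2) ^ 2 + ((H + 2) ^ 2 + (H + 2)) * L + ((H + 2) ^ 2 - (h + 1) ^ 2) := by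
        rcases le_or_gt (2 ^ H) (N + 2 ^ h) with hk | hk
        · rw [searchPotential_of_le hk]
          have : (0 : ℝ) ≤ ((H + 2) ^ 2 + (H + 2)) * L := by positivity
          nlinarith
        · have hhH := hlt hk
          rw [searchPotential_before hk hle]
          have hL' : (a - (N + 2 ^ h)).size ≤ L := Nat.size_le_size (by omega)
          split_ifs with hc
          · have : ((a - (N + 2 ^ h)).size : ℝ) ≤ L := by exact_mod_cast hL'
            have : (((H : ℝ) + 2) ^ 2 + (H + 2)) * (a - (N + 2 ^ h)).size ≤
              ((H + 2) ^ 2 + (H + 2)) * L := by gcongr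
            push_cast
            nlinarith
          -- The step becomes too long for the gap only if the gap has lost a bit. If `L = h + 1`,
          -- subtracting `2 ^ h` removes its leading bit.
          · have hL'' : (a - (N + 2 ^ h)).size + 1 ≤ L := by
              rcases Nat.lt_or_ge (h + 1) L with h1 | h1
              · omega
              · have : L = h + 1 := by omega
                rw [this]
                refine Nat.succ_le_succ (Nat.size_le.2 ?_)
                have := Nat.size_le.1 (hLdef ▸ this.le)
                rw [pow_succ] at this
                omega
            have : ((a - (N + 2 ^ h)).size : ℝ) + 1 ≤ L := by exact_mod_cast hL''
            have : (((H : ℝ) + 2) ^ 2 + (H + 2)) * ((a - (N + 2 ^ h)).size + 1) ≤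
              ((H + 2) ^ 2 + (H + 2)) * L := by gcongr
            push_cast
            nlinarith
      rw [hrej0, hcur]
      push_cast
      have := mul_le_mul_of_nonneg_left hacc hp0
      nlinarith
    · have hL : (a - N).size ≤ h := Nat.size_le.2 (by omega)
      rw [if_neg (by omega)] at hcur
      set L : ℕ := (a - N).size with hLdef
      have hDL : (0 : ℝ) ≤ ((H + 2) ^ 2 + (H + 2)) * L := by positivity
      have hacc : searchPotential H a (N + 2 ^ h) (h + 1 + 1) ≤ (H + 2) ^ 2 := by
        rcases le_or_gt (2 ^ H) (N + 2 ^ h) with hk | hk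
        · rw [searchPotential_of_le hk]; positivity
        · rw [searchPotential_beyond hk hgt]
          refine beyond_le_sq ?_
          have := hlt hk
          exact_mod_cast (by linarith : (h : ℝ) + 1 + 1 ≤ H + 1)
      -- The quadratic branch, reached when `h = L`, is also below the linear one.
      have hrej : searchPotential H a N h ≤
          (H + 2) ^ 2 + ((H + 2) ^ 2 + (H + 2)) * L + ((H + 2) ^ 2 + h) := by
        rw [hrej0]
        split_ifs <;> nlinarith
      have h1 := mul_le_mul_of_nonneg_left hacc hp0
      have h2 := mul_le_mul_of_nonneg_left hrej (by linarith : 0 ≤ 1 - p)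
      rw [hcur]
      push_cast
      nlinarith [mul_nonneg hp0 hDL, mul_nonneg hp0 hh0, mul_nonneg hp0 (sq_nonneg ((H : ℝ) + 2))]

/-- An antitone acceptance probability has a median on `[0, m]`. -/
theorem exists_median {F : ℕ → ℝ} (hF : Antitone F) (m : ℕ) :
    ∃ a ≤ m, (∀ x, 1 ≤ x → x ≤ a → 1 / 2 ≤ F x) ∧ ∀ x, a < x → x < m → F x ≤ 1 / 2 := by
  classical
  -- The default value is `0`, where `F` may be below `1 / 2`; hence the restriction `1 ≤ x`.
  -- Position `0` is never queried, because the step is positive.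
  refine ⟨Nat.findGreatest (fun x => 1 / 2 ≤ F x) m, Nat.findGreatest_le m, ?_, ?_⟩
  · intro x hx hxa
    have := Nat.findGreatest_of_ne_zero (P := fun x => 1 / 2 ≤ F x) (n := m) rfl (by omega)
    exact this.trans (hF hxa)
  · intro x hx hxm
    exact (not_le.1 (Nat.findGreatest_is_greatest (P := fun x => 1 / 2 ≤ F x) hx hxm.le)).le

/-! ### The tail of the number of iterations -/

/-- Integer coordinates for the main loop: `u = u₀ + pos * g`, `step = 2 ^ lvl / 2`, and the number
`count` of iterations done. -/
structure SearchState (n : ℕ) where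
  best : Option (Fin n)
  pos : ℕ
  lvl : ℕ
  count : ℕ

namespace SearchState

open scoped ENNReal

variable {n : ℕ}

/-- The state in which the loop is entered. -/
def start : SearchState n := ⟨none, 0, 1, 0⟩

/-- The state after an iteration with the given outcome. -/
def advance : Option (Fin n) → SearchState n → SearchState n
  | none, x => ⟨x.best, x.pos, x.lvl - 1, x.count + 1⟩
  | some s, x => ⟨some s, x.pos + 2 ^ x.lvl / 2, x.lvl + 1, x.count + 1⟩

theorem count_advance (x : SearchState n) (o : Option (Fin n)) :
    (advance o x).count = x.count + 1 := by
  cases o <;> rfl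

/-- The step never exceeds the accumulated position by more than `1`. -/
def Reachable (x : SearchState n) : Prop := 2 ^ x.lvl / 2 ≤ x.pos + 1

theorem reachable_start : (start : SearchState n).Reachable := by
  simp [Reachable, start]

theorem two_pow_succ_half (b : ℕ) : 2 ^ (b + 1) / 2 = 2 ^ b := by
  rw [pow_succ]; omega

theorem Reachable.advance {x : SearchState n} (hx : x.Reachable) (hb : x.lvl ≠ 0)
    (o : Option (Fin n)) : (advance o x).Reachable := by
  obtain ⟨h, hh⟩ := Nat.exists_eq_succ_of_ne_zero hb
  unfold Reachable at *
  cases o with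
  | none =>
    refine le_trans (Nat.div_le_div_right ?_) hx
    exact Nat.pow_le_pow_right (by norm_num) (Nat.sub_le _ _)
  | some s =>
    simp only [SearchState.advance, hh, Nat.succ_eq_add_one, two_pow_succ_half] at *
    rw [pow_succ]
    omega

/-- This keeps the level in the range where the potential is positive and bounded by `3 * (j + 2) ^
3`. -/
theorem Reachable.lvl_le {x : SearchState n} (hx : x.Reachable) {j : ℕ} (hj : x.pos < 2 ^ j) :
    x.lvl ≤ j + 1 := by
  rcases Nat.eq_zero_or_pos x.lvl with h | h
  · omega
  · obtain ⟨b, hb⟩ := Nat.exists_eq_succ_of_ne_zero h.ne'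
    unfold Reachable at hx
    rw [hb, Nat.succ_eq_add_one, two_pow_succ_half] at hx
    have : b ≤ j := (Nat.pow_le_pow_iff_right (a := 2) (by norm_num)).1 (by omega)
    omega

/-- With probability at least `1 - 2⁻ᵈ`, a search that ends below `2 ^ j` but not below
`2 ^ (j - 1)` takes at most this many iterations. -/
def iterationBound (d j : ℕ) : ℕ := 3 * (j + 2) ^ 3 * (4 * (j + 2) + 1 + d)

/-- The supermartingale controlling the runs that stay below `2 ^ j`. -/
def tailWeight (d : ℕ) (a : ℕ → ℕ) (j : ℕ) (x : SearchState n) : ℝ :=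
  (1 + 1 / (3 * (j + 2) ^ 3 : ℝ)) ^ x.count * searchPotential j (a j) x.pos x.lvl /
    2 ^ (4 * (j + 2) + 1 + d)

theorem tailWeight_nonneg (d : ℕ) (a : ℕ → ℕ) (j : ℕ) {x : SearchState n} (hx : x.Reachable) :
    0 ≤ tailWeight d a j x := by
  have := searchPotential_nonneg (H := j) (a := a j) (fun h => hx.lvl_le h)
  unfold tailWeight
  positivity

theorem one_le_tailWeight {d : ℕ} {a : ℕ → ℕ} {j : ℕ} {x : SearchState n} (hx : x.Reachable)
    (hj : x.pos < 2 ^ j) (hc : iterationBound d j ≤ x.count) : 1 ≤ tailWeight d a j x := by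
  have h1 := one_le_searchPotential (a := a j) hj (hx.lvl_le hj)
  have hK : (0 : ℝ) < 3 * (j + 2) ^ 3 := by positivity
  unfold tailWeight
  rw [le_div_iff₀ (by positivity), one_mul]
  -- By Bernoulli, the weight doubles every `3 * (j + 2) ^ 3` iterations, which explains the product
  -- in `iterationBound`.
  have h2 : (2 : ℝ) ≤ (1 + 1 / (3 * (j + 2) ^ 3 : ℝ)) ^ (3 * (j + 2) ^ 3) := by
    have := one_add_mul_le_pow (a := 1 / (3 * (j + 2) ^ 3 : ℝ))
      (by have : (0 : ℝ) ≤ 1 / (3 * (j + 2) ^ 3 : ℝ) := by positivity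
          linarith) (3 * (j + 2) ^ 3)
    refine le_trans (le_of_eq ?_) this
    push_cast
    field_simp
    norm_num
  calc (2 : ℝ) ^ (4 * (j + 2) + 1 + d)
      ≤ ((1 + 1 / (3 * (j + 2) ^ 3 : ℝ)) ^ (3 * (j + 2) ^ 3)) ^ (4 * (j + 2) + 1 + d) := by
        gcongr
    _ = (1 + 1 / (3 * (j + 2) ^ 3 : ℝ)) ^ iterationBound d j := by
        rw [← pow_mul, iterationBound]
    _ ≤ (1 + 1 / (3 * (j + 2) ^ 3 : ℝ)) ^ x.count :=
        pow_le_pow_right₀ (by have : (0 : ℝ) ≤ 1 / (3 * (j + 2) ^ 3 : ℝ) := by positivity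
                              linarith) hc
    _ ≤ _ := le_mul_of_one_le_right (by positivity) h1

/-- Of the exponent `4 * (j + 2) + 1 + d`, three copies of `j + 2` absorb the initial potential, the
fourth makes the bounds summable in `j`, and `d` is the target tail. -/
theorem tailWeight_start_le (d : ℕ) {a : ℕ → ℕ} {j : ℕ} (ha : a j ≤ 2 ^ j) :
    tailWeight d a j (start : SearchState n) ≤ (1 / 2) ^ d * ((1 / 2) * (1 / 2) ^ j) := by
  unfold tailWeight
  have h1 : searchPotential j (a j) 0 1 ≤ 3 * (j + 2) ^ 3 :=
    searchPotential_le ha (by omega)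
  have h2 : ((j : ℝ) + 2) ≤ 2 ^ (j + 2) := by
    exact_mod_cast (Nat.lt_two_pow_self (n := j + 2)).le
  have h3 : 3 * ((j : ℝ) + 2) ^ 3 ≤ 3 * (2 ^ (j + 2)) ^ 3 := by gcongr
  simp only [start, pow_zero, one_mul]
  rw [div_le_iff₀ (by positivity)]
  refine h1.trans (h3.trans ?_)
  have : (1 / 2 : ℝ) ^ d * (1 / 2 * (1 / 2) ^ j) * 2 ^ (4 * (j + 2) + 1 + d) =
      (1 / 2 * 2) ^ d * (1 / 2 * 2) ^ j * (4 * (2 ^ (j + 2)) ^ 3) := by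
    rw [mul_pow, mul_pow]
    ring
  rw [this]
  norm_num
  gcongr
  norm_num

theorem tailWeight_step {d : ℕ} {a : ℕ → ℕ} {j : ℕ} (ha : a j ≤ 2 ^ j) {F : ℕ → ℝ}
    (hF0 : ∀ i, 0 ≤ F i) (hF1 : ∀ i, F i ≤ 1) (hlow : ∀ i, 1 ≤ i → i ≤ a j → 1 / 2 ≤ F i)
    (hhigh : ∀ i, a j < i → i < 2 ^ j → F i ≤ 1 / 2) {x : SearchState n} (hx : x.Reachable)
    (hb : x.lvl ≠ 0) {p : ℝ} (hp : p = F (x.pos + 2 ^ x.lvl / 2)) {y z : SearchState n}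
    (hypos : y.pos = x.pos + 2 ^ x.lvl / 2) (hylvl : y.lvl = x.lvl + 1)
    (hyc : y.count = x.count + 1) (hz : z = SearchState.advance none x) :
    p * tailWeight d a j y + (1 - p) * tailWeight d a j z ≤ tailWeight d a j x := by
  have hp0 : 0 ≤ p := hp ▸ hF0 _
  have hp1 : p ≤ 1 := hp ▸ hF1 _
  obtain ⟨b, hb'⟩ := Nat.exists_eq_succ_of_ne_zero hb
  have hhalf : 2 ^ x.lvl / 2 = 2 ^ (x.lvl - 1) := by
    rw [hb', Nat.succ_eq_add_one, two_pow_succ_half, Nat.add_sub_cancel]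
  rw [hhalf] at hp hypos
  have hpos := Nat.two_pow_pos (x.lvl - 1)
  subst hz
  simp only [tailWeight, hypos, hylvl, hyc, SearchState.advance]
  rcases le_or_gt (2 ^ j) x.pos with hN | hN
  · rw [searchPotential_of_le hN, searchPotential_of_le hN,
      searchPotential_of_le (le_add_right hN)]
    simp
  · have hlvl := hx.lvl_le hN
    have hstep := searchPotential_step (a := a j) (p := p) hN (by omega) hlvl hp0 hp1
      (fun h => hp ▸ hlow _ (by omega) h) (fun h h' => hp ▸ hhigh _ h h')
    have hle := searchPotential_le (a := a j) (N := x.pos) ha hlvl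
    set G := searchPotential j (a j) x.pos x.lvl
    have hK : (0 : ℝ) < 3 * (j + 2) ^ 3 := by positivity
    set K : ℝ := 3 * (j + 2) ^ 3
    -- Since `G ≤ K`, an additive drop of `1` is a relative drop of at least `1 / K`.
    have hβ : (1 + 1 / K) * (G - 1) ≤ G := by
      have : G / K ≤ 1 := (div_le_one hK).2 hle
      have h0 : 0 ≤ 1 / K := by positivity
      have : (1 + 1 / K) * (G - 1) = G + G / K - 1 - 1 / K := by ring
      linarith
    have hc : (0 : ℝ) ≤ (1 + 1 / K) ^ x.count := by positivity
    rw [← mul_div_assoc, ← mul_div_assoc, ← add_div]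
    gcongr
    calc _ = (1 + 1 / K) ^ x.count * ((1 + 1 / K) *
          (p * searchPotential j (a j) (x.pos + 2 ^ (x.lvl - 1)) (x.lvl + 1) +
            (1 - p) * searchPotential j (a j) x.pos (x.lvl - 1))) := by rw [pow_succ]; ring
      _ ≤ (1 + 1 / K) ^ x.count * ((1 + 1 / K) * (G - 1)) := by gcongr
      _ ≤ _ := by gcongr

open Classical in
/-- The number of iterations is polylogarithmic in the final position with high probability. -/
theorem chainValue_iterationBound_lt {halt : SearchState n → Prop}
    (hhalt : ∀ x, x.lvl = 0 → halt x) {q : SearchState n → Option (Fin n) → ℝ≥0∞} {F : ℕ → ℝ}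
    (hF : Antitone F) (hF0 : ∀ i, 0 ≤ F i) (hF1 : ∀ i, F i ≤ 1)
    (hsome : ∀ x, ∑ s, q x (some s) = ENNReal.ofReal (F (x.pos + 2 ^ x.lvl / 2)))
    (hnone : ∀ x, q x none = ENNReal.ofReal (1 - F (x.pos + 2 ^ x.lvl / 2))) (d t : ℕ) :
    chainValue halt SearchState.advance q
      (fun x => if iterationBound d x.pos.size < x.count then 1 else 0) t start ≤
      ENNReal.ofReal ((1 / 2) ^ d) := by
  -- The final position is not known in advance, so every horizon `2 ^ j` gets its own median and
  -- supermartingale.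
  choose a ha hlow hhigh using fun j : ℕ => exists_median hF (2 ^ j)
  have hsum : ∑' j, ENNReal.ofReal (tailWeight d a j (start : SearchState n)) ≤
      ENNReal.ofReal ((1 / 2) ^ d) := by
    have hgeo : HasSum (fun j : ℕ => (1 / 2 : ℝ) ^ d * ((1 / 2) * (1 / 2) ^ j)) ((1 / 2) ^ d) := by
      have := (hasSum_geometric_two.mul_left (1 / 2 : ℝ)).mul_left ((1 / 2 : ℝ) ^ d)
      simpa using this
    calc _ ≤ ∑' j : ℕ, ENNReal.ofReal ((1 / 2 : ℝ) ^ d * ((1 / 2) * (1 / 2) ^ j)) :=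
          ENNReal.tsum_le_tsum fun j => ENNReal.ofReal_le_ofReal (tailWeight_start_le d (ha j))
      _ = _ := by
          rw [← ENNReal.ofReal_tsum_of_nonneg (fun j => by positivity) hgeo.summable,
            hgeo.tsum_eq]
  refine le_trans (chainValue_le_of_superharmonic (I := Reachable)
    (W := fun x => ∑' j, ENNReal.ofReal (tailWeight d a j x))
    (fun x o hx hh => hx.advance (fun h => hh (hhalt x h)) o) ?_ ?_ t reachable_start) hsum
  · intro x hx
    split_ifs with hc
    · refine le_trans ?_ (ENNReal.le_tsum x.pos.size)
      rw [← ENNReal.ofReal_one]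
      exact ENNReal.ofReal_le_ofReal (one_le_tailWeight hx (Nat.lt_size_self _) hc.le)
    · exact zero_le
  · intro x hx hh
    have hb : x.lvl ≠ 0 := fun h => hh (hhalt x h)
    simp_rw [← ENNReal.tsum_mul_left]
    rw [← tsum_fintype (L := .unconditional _), ENNReal.tsum_comm]
    refine ENNReal.tsum_le_tsum fun j => ?_
    rw [tsum_fintype, Fintype.sum_option]
    set p := F (x.pos + 2 ^ x.lvl / 2)
    -- The weight ignores the selected candidate, so all acceptances merge into one outcome.
    set y : SearchState n := ⟨none, x.pos + 2 ^ x.lvl / 2, x.lvl + 1, x.count + 1⟩ with hy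
    have hW : ∀ s : Fin n, tailWeight d a j (SearchState.advance (some s) x) =
        tailWeight d a j y := fun s => rfl
    simp_rw [hW]
    rw [← Finset.sum_mul, hsome, hnone]
    have hyR : y.Reachable := by
      have hstep : 2 ^ (x.lvl + 1) / 2 ≤ x.pos + 2 ^ x.lvl / 2 + 1 := by
        obtain ⟨h, hh⟩ := Nat.exists_eq_succ_of_ne_zero hb
        unfold Reachable at hx
        rw [hh, Nat.succ_eq_add_one, two_pow_succ_half] at hx ⊢
        rw [two_pow_succ_half, pow_succ]
        omega
      exact hstep
    have hp0 : 0 ≤ p := hF0 _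
    have hp1 : p ≤ 1 := hF1 _
    rw [← ENNReal.ofReal_mul hp0, ← ENNReal.ofReal_mul (by linarith), add_comm,
      ← ENNReal.ofReal_add (mul_nonneg hp0 (tailWeight_nonneg d a j hyR))
        (mul_nonneg (by linarith) (tailWeight_nonneg d a j (hx.advance hb none)))]
    exact ENNReal.ofReal_le_ofReal (tailWeight_step (ha j) hF0 hF1 (hlow j) (hhigh j) hx hb rfl
      rfl rfl rfl rfl)

end SearchState

/-! ### Privacy of a single iteration -/

section Laplace

open scoped ENNReal

/-- Moving Laplace noise by `c` costs a factor `exp (|c| / b)`. -/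
theorem lintegral_laplace_le {b : ℝ} (hb : 0 < b) (c : ℝ) {f : ℝ → ℝ≥0∞} (hf : Measurable f) :
    ∫⁻ x, f (x + c) ∂laplace b ≤ ENNReal.ofReal (Real.exp (|c| / b)) * ∫⁻ x, f x ∂laplace b := by
  have hm : Measurable fun x : ℝ => ENNReal.ofReal (Real.exp (-|x| / b) / (2 * b)) := by fun_prop
  unfold laplace
  rw [if_pos hb, lintegral_withDensity_eq_lintegral_mul _ hm (by fun_prop),
    lintegral_withDensity_eq_lintegral_mul _ hm hf, ← lintegral_const_mul _ (by fun_prop),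
    ← lintegral_add_right_eq_self (μ := (volume : Measure ℝ))
      (fun x => ENNReal.ofReal (Real.exp (|c| / b)) *
        ((fun x : ℝ => ENNReal.ofReal (Real.exp (-|x| / b) / (2 * b))) * f) x) c]
  refine lintegral_mono fun x => ?_
  simp only [Pi.mul_apply]
  rw [← mul_assoc, ← ENNReal.ofReal_mul (by positivity)]
  gcongr
  rw [← mul_div_assoc, ← Real.exp_add, ← add_div]
  gcongr
  linarith [abs_add_le x c]

theorem lintegral_pi_le_of_coordinate {ι : Type*} [Fintype ι] [DecidableEq ι] {μ : ι → Measure ℝ}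
    [∀ i, IsProbabilityMeasure (μ i)] (i : ι) {f g : (ι → ℝ) → ℝ≥0∞} (hf : Measurable f)
    (hg : Measurable g)
    (h : ∀ x, ∫⁻ t, f (Function.update x i t) ∂μ i ≤ ∫⁻ t, g (Function.update x i t) ∂μ i) :
    ∫⁻ x, f x ∂Measure.pi μ ≤ ∫⁻ x, g x ∂Measure.pi μ := by
  refine lintegral_le_of_lmarginal_le {i} hf hg fun x => ?_
  rw [lmarginal_singleton, lmarginal_singleton]
  exact h x

end Laplace

namespace TuningSetup

open scoped ENNReal

variable {X Y H Θ : Type*} [MeasurableSpace Θ] (P : TuningSetup X Y H Θ)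

/-- If moving the threshold noise by `1 / k` and the noise of candidate `s` by `2 / k` maps `A`
into `B`, then `A` is at most `exp ε₀` times as likely as `B`. -/
theorem noiseLaw_le (s : Fin P.n) {A B : Set P.Noise} (hB : MeasurableSet B)
    (h : ∀ ω ∈ A, (ω.1 + 1 / P.k, Function.update ω.2 s (ω.2 s + 2 / P.k)) ∈ B) :
    P.noiseLaw A ≤ ENNReal.ofReal (Real.exp P.ε₀) * P.noiseLaw B := by
  classical
  have hε := P.ε₀_pos
  have hk : (0 : ℝ) < P.k := by exact_mod_cast P.k_pos
  set f : P.Noise → ℝ≥0∞ := B.indicator 1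
  have hf : Measurable f := measurable_one.indicator hB
  have hup : Measurable fun ω : P.Noise => Function.update ω.2 s (ω.2 s + 2 / P.k) := by
    refine measurable_pi_lambda _ fun i => ?_
    by_cases hi : i = s
    · subst hi; simp only [Function.update_self]; fun_prop
    · simp only [Function.update_of_ne hi]; fun_prop
  have h1 : P.noiseLaw A ≤ ∫⁻ ω, f (ω.1 + 1 / P.k, Function.update ω.2 s (ω.2 s + 2 / P.k))
      ∂P.noiseLaw := by
    calc P.noiseLaw A ≤ P.noiseLaw
          ((fun ω : P.Noise => (ω.1 + 1 / (P.k : ℝ), Function.update ω.2 s (ω.2 s + 2 / P.k))) ⁻¹' B) :=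
          measure_mono h
      _ = _ := by
          rw [← lintegral_indicator_one (((by fun_prop : Measurable fun ω : P.Noise =>
            ω.1 + 1 / (P.k : ℝ)).prodMk hup) hB)]
          rfl
  refine h1.trans ?_
  rw [← lintegral_indicator_one hB]
  change _ ≤ _ * ∫⁻ ω, f ω ∂P.noiseLaw
  unfold noiseLaw
  rw [lintegral_prod _ (by fun_prop), lintegral_prod _ (by fun_prop)]
  -- A shift by `2 / k` at scale `4 / (k ε₀)` costs `ε₀ / 2`; so does the threshold shift by `1 / k`
  -- at scale `2 / (k ε₀)`.
  have hγ : ∀ ξ : ℝ, ∫⁻ γ, f (ξ, Function.update γ s (γ s + 2 / P.k))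
        ∂(Measure.pi fun _ : Fin P.n => laplace (4 / (P.k * P.ε₀))) ≤
      ENNReal.ofReal (Real.exp (P.ε₀ / 2)) *
        ∫⁻ γ, f (ξ, γ) ∂(Measure.pi fun _ : Fin P.n => laplace (4 / (P.k * P.ε₀))) := by
    intro ξ
    rw [← lintegral_const_mul _ (by fun_prop)]
    have hup' : Measurable fun γ : Fin P.n → ℝ => Function.update γ s (γ s + 2 / P.k) :=
      hup.comp (measurable_const (a := (0 : ℝ)) |>.prodMk measurable_id)
    refine lintegral_pi_le_of_coordinate s (by fun_prop) (by fun_prop) fun γ => ?_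
    rw [lintegral_const_mul _ (by fun_prop)]
    simp only [Function.update_idem, Function.update_self]
    refine (lintegral_laplace_le (by positivity) (2 / (P.k : ℝ))
      (f := fun t => f (ξ, Function.update γ s t)) (by fun_prop)).trans (le_of_eq ?_)
    congr 3
    rw [abs_of_pos (by positivity)]
    field_simp
    norm_num
  calc _ ≤ ∫⁻ ξ, ENNReal.ofReal (Real.exp (P.ε₀ / 2)) *
          ∫⁻ γ, f (ξ + 1 / P.k, γ) ∂(Measure.pi fun _ : Fin P.n => laplace (4 / (P.k * P.ε₀)))
          ∂laplace (2 / (P.k * P.ε₀)) := lintegral_mono fun ξ => hγ _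
    _ ≤ ENNReal.ofReal (Real.exp (P.ε₀ / 2)) * (ENNReal.ofReal (Real.exp (P.ε₀ / 2)) *
          ∫⁻ ξ, ∫⁻ γ, f (ξ, γ) ∂(Measure.pi fun _ : Fin P.n => laplace (4 / (P.k * P.ε₀)))
          ∂laplace (2 / (P.k * P.ε₀))) := by
        have hmeas : Measurable fun ξ => ∫⁻ γ, f (ξ, γ)
            ∂(Measure.pi fun _ : Fin P.n => laplace (4 / (P.k * P.ε₀))) := hf.lintegral_prod_right'
        rw [lintegral_const_mul _ (by fun_prop)]
        gcongr
        refine (lintegral_laplace_le (by positivity) (1 / (P.k : ℝ)) hmeas).trans (le_of_eq ?_)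
        congr 3
        rw [abs_of_pos (by positivity)]
        field_simp
    _ = _ := by
        rw [← mul_assoc, ← ENNReal.ofReal_mul (by positivity), ← Real.exp_add, add_halves]

/-- The variant of `noiseLaw_le` in which only the threshold noise moves. -/
theorem noiseLaw_le_of_threshold {A B : Set P.Noise} (hB : MeasurableSet B)
    (h : ∀ ω ∈ A, (ω.1 + 1 / P.k, ω.2) ∈ B) :
    P.noiseLaw A ≤ ENNReal.ofReal (Real.exp P.ε₀) * P.noiseLaw B := by
  have hε := P.ε₀_pos
  have hk : (0 : ℝ) < P.k := by exact_mod_cast P.k_pos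
  set f : P.Noise → ℝ≥0∞ := B.indicator 1
  have hf : Measurable f := measurable_one.indicator hB
  have h1 : P.noiseLaw A ≤ ∫⁻ ω, f (ω.1 + 1 / P.k, ω.2) ∂P.noiseLaw := by
    calc P.noiseLaw A ≤ P.noiseLaw ((fun ω : P.Noise => (ω.1 + 1 / (P.k : ℝ), ω.2)) ⁻¹' B) :=
          measure_mono h
      _ = _ := by
          rw [← lintegral_indicator_one ((by fun_prop : Measurable fun ω : P.Noise =>
            (ω.1 + 1 / (P.k : ℝ), ω.2)) hB)]
          rfl
  refine h1.trans ?_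
  rw [← lintegral_indicator_one hB]
  change _ ≤ _ * ∫⁻ ω, f ω ∂P.noiseLaw
  unfold noiseLaw
  rw [lintegral_prod _ (by fun_prop), lintegral_prod _ (by fun_prop)]
  have hmeas : Measurable fun ξ => ∫⁻ γ, f (ξ, γ)
      ∂(Measure.pi fun _ : Fin P.n => laplace (4 / (P.k * P.ε₀))) := hf.lintegral_prod_right'
  refine (lintegral_laplace_le (by positivity) (1 / (P.k : ℝ)) hmeas).trans ?_
  gcongr
  rw [abs_of_pos (by positivity)]
  have : 1 / (P.k : ℝ) / (2 / (P.k * P.ε₀)) = P.ε₀ / 2 := by field_simp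
  linarith

/-- The law of the outcome of one iteration in the state `σ`. -/
def acceptLaw (v : Fin P.n → ℝ) (σ : LoopState P.n) (o : Option (Fin P.n)) : ℝ≥0∞ :=
  P.noiseLaw {ω | P.accepted v ω σ = o}

theorem measurableSet_accepted (v : Fin P.n → ℝ) (σ : LoopState P.n) (o : Option (Fin P.n)) :
    MeasurableSet {ω | P.accepted v ω σ = o} :=
  P.measurable_accepted (v := fun _ : P.Noise => v) (w := fun ω => ω) (σ := fun _ => σ)
    measurable_const measurable_id measurable_const measurable_const
    (MeasurableSet.of_discrete (s := {o}))

theorem accepted_eq_none_iff {v : Fin P.n → ℝ} {ω : P.Noise} {σ : LoopState P.n} :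
    P.accepted v ω σ = none ↔ ∀ s, v s + ω.2 s < σ.u + σ.step * P.g + ω.1 := by
  classical
  simp [accepted, List.find?_eq_none]

theorem accepted_eq_some_iff {v : Fin P.n → ℝ} {ω : P.Noise} {σ : LoopState P.n} {s : Fin P.n} :
    P.accepted v ω σ = some s ↔ σ.u + σ.step * P.g + ω.1 ≤ v s + ω.2 s ∧
      ∀ j < s, v j + ω.2 j < σ.u + σ.step * P.g + ω.1 := by
  classical
  unfold accepted
  rw [List.find?_eq_some_iff_getElem]
  simp only [decide_eq_true_eq, List.getElem_finRange, List.length_finRange]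
  constructor
  · rintro ⟨h1, i, hi, his, h2⟩
    refine ⟨h1, fun j hj => ?_⟩
    have hji : (j : ℕ) < i := by rw [← his] at hj; exact hj
    simpa using h2 j hji
  · rintro ⟨h1, h2⟩
    refine ⟨h1, s, s.2, rfl, fun j hj => ?_⟩
    simpa using h2 ⟨j, hj.trans s.2⟩ hj

/-- Raising the threshold by `1 / k` preserves every rejection. The winner, if there is one, gains
`2 / k`: one `1 / k` for the threshold and one for its own utility. Only the winner's noise moves,
so `n` does not enter. -/
theorem acceptLaw_le {v w : Fin P.n → ℝ} (hvw : ∀ s, |v s - w s| ≤ 1 / P.k) (σ : LoopState P.n)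
    (o : Option (Fin P.n)) :
    P.acceptLaw v σ o ≤ ENNReal.ofReal (Real.exp P.ε₀) * P.acceptLaw w σ o := by
  have hk : (0 : ℝ) < P.k := by exact_mod_cast P.k_pos
  have h2k : (2 : ℝ) / P.k = 1 / P.k + 1 / P.k := by ring
  cases o with
  | none =>
    refine P.noiseLaw_le_of_threshold (P.measurableSet_accepted w σ none) fun ω hω => ?_
    simp only [Set.mem_ofPred_eq, accepted_eq_none_iff] at hω ⊢
    intro s
    have := abs_le.1 (hvw s)
    linarith [hω s]
  | some s =>
    refine P.noiseLaw_le s (P.measurableSet_accepted w σ (some s)) fun ω hω => ?_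
    simp only [Set.mem_ofPred_eq, accepted_eq_some_iff] at hω ⊢
    refine ⟨?_, fun j hj => ?_⟩
    · have := abs_le.1 (hvw s)
      rw [Function.update_self]
      linarith [hω.1]
    · have := abs_le.1 (hvw j)
      rw [Function.update_of_ne hj.ne]
      linarith [hω.2 j hj]

/-- The probability that a query with value `x` is accepted. -/
def acceptProb (v : Fin P.n → ℝ) (x : ℝ) : ℝ :=
  P.noiseLaw.real {ω | ∃ s, x + ω.1 ≤ v s + ω.2 s}

theorem antitone_acceptProb (v : Fin P.n → ℝ) : Antitone (P.acceptProb v) := by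
  intro x y hxy
  refine measureReal_mono ?_
  rintro ω ⟨s, hs⟩
  exact ⟨s, by linarith⟩

theorem acceptLaw_none (v : Fin P.n → ℝ) (σ : LoopState P.n) :
    P.acceptLaw v σ none = ENNReal.ofReal (1 - P.acceptProb v (σ.u + σ.step * P.g)) := by
  have hset : {ω : P.Noise | ∃ s, σ.u + σ.step * P.g + ω.1 ≤ v s + ω.2 s} =
      {ω | P.accepted v ω σ = none}ᶜ := by
    ext ω
    simp [accepted_eq_none_iff]
  rw [acceptProb, hset, probReal_compl_eq_one_sub (P.measurableSet_accepted v σ none),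
    sub_sub_cancel, ofReal_measureReal, acceptLaw]

theorem lintegral_accepted (v : Fin P.n → ℝ) (σ : LoopState P.n) (f : Option (Fin P.n) → ℝ≥0∞) :
    ∫⁻ ω, f (P.accepted v ω σ) ∂P.noiseLaw = ∑ o, P.acceptLaw v σ o * f o := by
  have hm : Measurable fun ω => P.accepted v ω σ := measurable_to_countable' fun o =>
    P.measurableSet_accepted v σ o
  rw [← lintegral_map (f := f) (measurable_from_top) hm, lintegral_fintype]
  refine Finset.sum_congr rfl fun o _ => ?_
  rw [Measure.map_apply hm (MeasurableSet.of_discrete), mul_comm]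
  rfl

theorem sum_acceptLaw_some (v : Fin P.n → ℝ) (σ : LoopState P.n) :
    ∑ s, P.acceptLaw v σ (some s) = ENNReal.ofReal (P.acceptProb v (σ.u + σ.step * P.g)) := by
  have h := P.lintegral_accepted v σ fun _ => 1
  simp only [mul_one, lintegral_one, measure_univ, Fintype.sum_option, acceptLaw_none] at h
  have hp0 : 0 ≤ P.acceptProb v (σ.u + σ.step * P.g) := measureReal_nonneg
  have hp1 : P.acceptProb v (σ.u + σ.step * P.g) ≤ 1 := measureReal_le_one
  have h2 : (1 : ℝ≥0∞) = ENNReal.ofReal (1 - P.acceptProb v (σ.u + σ.step * P.g)) +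
      ENNReal.ofReal (P.acceptProb v (σ.u + σ.step * P.g)) := by
    rw [← ENNReal.ofReal_add (by linarith) hp0]
    simp
  rw [h2] at h
  exact ((ENNReal.add_right_inj ENNReal.ofReal_ne_top).1 h).symm

end TuningSetup

/-! ### The law of the main loop -/

section Cons

open scoped ENNReal

/-- The sequence `a, ω 0, ω 1, …`. -/
def natCons {α : Type*} (a : α) (ω : ℕ → α) : ℕ → α
  | 0 => a
  | i + 1 => ω i

/-- An i.i.d. sequence is its first term followed by an i.i.d. sequence. -/
theorem measurePreserving_natCons {α : Type*} [MeasurableSpace α] (μ : Measure α)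
    [IsProbabilityMeasure μ] :
    MeasurePreserving (fun p : α × (ℕ → α) => natCons p.1 p.2)
      (μ.prod (Measure.infinitePi fun _ : ℕ => μ)) (Measure.infinitePi fun _ : ℕ => μ) := by
  have hm : Measurable fun p : α × (ℕ → α) => natCons p.1 p.2 := by
    refine measurable_pi_lambda _ fun i => ?_
    cases i with
    | zero => exact measurable_fst
    | succ i => exact (measurable_pi_apply i).comp measurable_snd
  refine ⟨hm, Measure.eq_infinitePi _ fun s t ht => ?_⟩
  rw [Measure.map_apply hm (MeasurableSet.pi s.countable_toSet fun i _ => ht i)]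
  set s' : Finset ℕ := (s.erase 0).image Nat.pred
  have hs' : ∀ i, i ∈ s' ↔ i + 1 ∈ s := by
    intro i
    simp only [s', Finset.mem_image, Finset.mem_erase]
    constructor
    · rintro ⟨j, ⟨hj0, hj⟩, rfl⟩
      have : j.pred + 1 = j := Nat.succ_pred hj0
      rwa [this]
    · exact fun h => ⟨i + 1, ⟨by omega, h⟩, rfl⟩
  have hpre : (fun p : α × (ℕ → α) => natCons p.1 p.2) ⁻¹' (Set.pi s t) =
      (if 0 ∈ s then t 0 else Set.univ) ×ˢ Set.pi s' fun i => t (i + 1) := by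
    ext ⟨a, ω⟩
    simp only [Set.mem_preimage, Set.mem_pi, Finset.mem_coe, Set.mem_prod, hs']
    constructor
    · intro h
      refine ⟨?_, fun i hi => h (i + 1) hi⟩
      split_ifs with h0
      · exact h 0 h0
      · trivial
    · rintro ⟨h0, h⟩ i hi
      cases i with
      | zero =>
        rw [if_pos (Finset.mem_coe.1 hi)] at h0
        exact h0
      | succ i => exact h i hi
  rw [hpre, Measure.prod_prod, Measure.infinitePi_pi _ fun i _ => ht _]
  have hprod : ∏ i ∈ s', μ (t (i + 1)) = ∏ i ∈ s.erase 0, μ (t i) := by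
    rw [Finset.prod_image]
    · refine Finset.prod_congr rfl fun i hi => ?_
      rw [Nat.pred_eq_sub_one, Nat.sub_add_cancel (Nat.pos_of_ne_zero (Finset.ne_of_mem_erase hi))]
    · intro i hi j hj hij
      have := Finset.ne_of_mem_erase hi
      have := Finset.ne_of_mem_erase hj
      simp only [Nat.pred_eq_sub_one] at hij
      omega
  rw [hprod]
  split_ifs with h0
  · exact Finset.mul_prod_erase s (fun i => μ (t i)) h0
  · rw [measure_univ, one_mul, Finset.erase_eq_of_notMem h0]

end Cons

namespace TuningSetup

open scoped ENNReal

variable {X Y H Θ : Type*} [MeasurableSpace Θ] (P : TuningSetup X Y H Θ)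

/-- The loop variables with the given integer coordinates. -/
def toLoop (x : SearchState P.n) : LoopState P.n := ⟨x.best, P.u₀ + x.pos * P.g, 2 ^ x.lvl / 2⟩

theorem halted_toLoop_of_lvl {x : SearchState P.n} (hx : x.lvl = 0) : P.Halted (P.toLoop x) := by
  left
  simp [toLoop, hx]

theorem toLoop_advance {x : SearchState P.n} (hx : ¬P.Halted (P.toLoop x)) (v : Fin P.n → ℝ)
    (ω : P.Noise) :
    P.toLoop (SearchState.advance (P.accepted v ω (P.toLoop x)) x) =
      P.iterate v ω (P.toLoop x) := by
  obtain ⟨b, hb⟩ := Nat.exists_eq_succ_of_ne_zero fun h => hx (P.halted_toLoop_of_lvl h)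
  unfold iterate
  rcases P.accepted v ω (P.toLoop x) with _ | s
  · simp only [SearchState.advance, toLoop, hb, Nat.succ_eq_add_one, Nat.add_sub_cancel, pow_succ]
    congr 1
    omega
  · simp only [SearchState.advance, toLoop, hb, Nat.succ_eq_add_one, pow_succ]
    congr 1
    · push_cast
      ring
    · omega

open Classical in
/-- The integer coordinates after `t` iterations from `x`, by recursion on the first iteration. -/
def searchRun (v : Fin P.n → ℝ) : ℕ → SearchState P.n → (ℕ → P.Noise) → SearchState P.n
  | 0, x, _ => x
  | t + 1, x, ω =>
    if P.Halted (P.toLoop x) then x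
    else searchRun v t (SearchState.advance (P.accepted v (ω 0) (P.toLoop x)) x) fun i => ω (i + 1)

open Classical in
theorem searchRun_succ (v : Fin P.n → ℝ) (t : ℕ) (x : SearchState P.n) (ω : ℕ → P.Noise) :
    P.searchRun v (t + 1) x ω =
      if P.Halted (P.toLoop (P.searchRun v t x ω)) then P.searchRun v t x ω
      else SearchState.advance (P.accepted v (ω t) (P.toLoop (P.searchRun v t x ω)))
        (P.searchRun v t x ω) := by
  induction t generalizing x ω with
  | zero => rfl
  | succ t ih =>
    rw [searchRun]
    by_cases hx : P.Halted (P.toLoop x)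
    · simp [searchRun, hx]
    · rw [if_neg hx, ih]
      simp only [searchRun, if_neg hx]

theorem toLoop_searchRun (v : Fin P.n → ℝ) (t : ℕ) (ω : ℕ → P.Noise) :
    P.toLoop (P.searchRun v t SearchState.start ω) = P.traj v ω t := by
  induction t with
  | zero => simp [searchRun, traj, toLoop, init, SearchState.start]
  | succ t ih =>
    rw [searchRun_succ, traj, ← ih]
    split_ifs with hh
    · rfl
    · exact P.toLoop_advance hh v (ω t)

theorem measurable_searchRun (v : Fin P.n → ℝ) (t : ℕ) (x : SearchState P.n)
    (ψ : SearchState P.n → ℝ≥0∞) : Measurable fun ω => ψ (P.searchRun v t x ω) := by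
  induction t generalizing x with
  | zero => simp only [searchRun]; exact measurable_const
  | succ t ih =>
    simp only [searchRun]
    split_ifs with hx
    · exact measurable_const
    · have h : Measurable fun p : (ℕ → P.Noise) × Option (Fin P.n) =>
          ψ (P.searchRun v t (SearchState.advance p.2 x) p.1) :=
        measurable_from_prod_countable_left fun o => ih (SearchState.advance o x)
      have hacc : Measurable fun ω : ℕ → P.Noise => P.accepted v (ω 0) (P.toLoop x) :=
        P.measurable_accepted (v := fun _ : ℕ → P.Noise => v) (w := fun ω => ω 0)
          (σ := fun _ => P.toLoop x) measurable_const (measurable_pi_apply 0) measurable_const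
          measurable_const
      have hshift : Measurable fun ω : ℕ → P.Noise => fun i => ω (i + 1) :=
        measurable_pi_lambda _ fun i => measurable_pi_apply _
      exact h.comp (hshift.prodMk hacc)

theorem lintegral_searchRun (v : Fin P.n → ℝ) (t : ℕ) (x : SearchState P.n)
    (ψ : SearchState P.n → ℝ≥0∞) :
    ∫⁻ ω, ψ (P.searchRun v t x ω) ∂(Measure.infinitePi fun _ : ℕ => P.noiseLaw) =
      chainValue (fun x => P.Halted (P.toLoop x)) SearchState.advance
        (fun x => P.acceptLaw v (P.toLoop x)) ψ t x := by
  induction t generalizing x with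
  | zero => simp [searchRun, chainValue]
  | succ t ih =>
    have hmp := measurePreserving_natCons P.noiseLaw
    have hmeas := ((P.measurable_searchRun v (t + 1) x ψ).comp hmp.measurable).aemeasurable
      (μ := P.noiseLaw.prod (Measure.infinitePi fun _ : ℕ => P.noiseLaw))
    simp only [Function.comp_def] at hmeas
    rw [← hmp.lintegral_comp (P.measurable_searchRun v (t + 1) x ψ), lintegral_prod _ hmeas]
    simp only [searchRun, chainValue]
    split_ifs with hx
    · simp
    · simp only [natCons, ih]
      exact P.lintegral_accepted v (P.toLoop x) fun o =>
        chainValue (fun x => P.Halted (P.toLoop x)) SearchState.advance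
          (fun x => P.acceptLaw v (P.toLoop x)) ψ t (SearchState.advance o x)

/-! ### Termination and privacy of the loop for fixed utilities -/

/-- All runs of the loop are left after a common number of iterations. -/
theorem exists_halted_uniform : ∃ T, ∀ v ω, P.Halted (P.traj v ω T) := by
  have hg := P.g_mem.1
  obtain ⟨m, hm⟩ := exists_nat_gt ((1 - P.u₀) / P.g)
  refine ⟨2 * m, fun v ω => ?_⟩
  -- Here `a` counts acceptances and `f` rejections. A nonzero step forces `f ≤ a`, while `u < 1`
  -- bounds `a`.
  have key : ∀ t, P.Halted (P.traj v ω t) ∨ ∃ a f : ℕ, a + f = t ∧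
      P.u₀ + a * P.g ≤ (P.traj v ω t).u ∧ (P.traj v ω t).step * 2 ^ f ≤ 2 ^ a := by
    intro t
    induction t with
    | zero => exact Or.inr ⟨0, 0, rfl, by simp [traj, init], by simp [traj, init]⟩
    | succ t ih =>
      by_cases hn : P.Halted (P.traj v ω t)
      · left; simpa only [traj, if_pos hn] using hn
      obtain ⟨a, f, hat, hu, hs⟩ := ih.resolve_left hn
      right
      have h1 : 1 ≤ (P.traj v ω t).step := by
        by_contra h
        exact hn (Or.inl (by omega))
      have h1' : (1 : ℝ) ≤ (P.traj v ω t).step := by exact_mod_cast h1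
      simp only [traj, if_neg hn, iterate]
      split
      · refine ⟨a + 1, f, by omega, ?_, ?_⟩
        · push_cast
          nlinarith
        · rw [pow_succ]
          nlinarith
      · refine ⟨a, f + 1, by omega, hu, le_trans ?_ hs⟩
        rw [pow_succ, mul_comm (2 ^ f) 2, ← mul_assoc]
        exact Nat.mul_le_mul_right _ (Nat.div_mul_le_self _ 2)
  by_contra hn
  obtain ⟨a, f, hat, hu, hs⟩ := (key (2 * m)).resolve_left hn
  have h1 : 1 ≤ (P.traj v ω (2 * m)).step := by
    by_contra h
    exact hn (Or.inl (by omega))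
  have hu1 : (P.traj v ω (2 * m)).u < 1 := by
    by_contra h
    exact hn (Or.inr (not_lt.1 h))
  have hfa : f ≤ a := (Nat.pow_le_pow_iff_right (a := 2) (by norm_num)).1
    (le_trans (Nat.le_mul_of_pos_left _ h1) hs)
  have hma : (m : ℝ) ≤ a := by exact_mod_cast (by omega : m ≤ a)
  rw [div_lt_iff₀ hg] at hm
  nlinarith

theorem traj_eq_of_halted {v : Fin P.n → ℝ} {ω : ℕ → P.Noise} {t s : ℕ} (hts : t ≤ s)
    (h : P.Halted (P.traj v ω t)) : P.traj v ω s = P.traj v ω t := by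
  induction s, hts using Nat.le_induction with
  | base => rfl
  | succ s hs ih => rw [traj, if_pos (by rwa [ih]), ih]

theorem final_eq_traj {v : Fin P.n → ℝ} {ω : ℕ → P.Noise} {T : ℕ}
    (h : P.Halted (P.traj v ω T)) : P.final v ω = P.traj v ω T :=
  (P.traj_eq_of_halted (Nat.sInf_le h) (Nat.sInf_mem (P.exists_halted v ω))).symm

theorem exists_final_eq_toLoop (v : Fin P.n → ℝ) (ω : ℕ → P.Noise) :
    ∃ x, P.final v ω = P.toLoop x :=
  ⟨_, (P.toLoop_searchRun v (P.count v ω) ω).symm⟩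

/-- Privacy of the main loop for utilities that differ by at most `1 / k`. The privacy loss `B` may
be any bound for the loss of `iterationBound` many iterations. -/
theorem lintegral_final_le {v w : Fin P.n → ℝ} (hvw : ∀ s, |v s - w s| ≤ 1 / P.k) {B : ℝ → ℝ}
    {d : ℕ} (hB : ∀ N c : ℕ, c ≤ SearchState.iterationBound d N.size →
      c * P.ε₀ ≤ B (P.u₀ + N * P.g))
    {φ : Option (Fin P.n) × ℝ → ℝ≥0∞} (hφ : ∀ o, φ o ≤ 1) :
    ∫⁻ ω, φ ((P.final v ω).best, (P.final v ω).u)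
        ∂(Measure.infinitePi fun _ : ℕ => P.noiseLaw) ≤
      ∫⁻ ω, ENNReal.ofReal (Real.exp (B (P.final w ω).u)) *
          φ ((P.final w ω).best, (P.final w ω).u)
        ∂(Measure.infinitePi fun _ : ℕ => P.noiseLaw) + ENNReal.ofReal ((1 / 2) ^ d) := by
  classical
  obtain ⟨T, hT⟩ := P.exists_halted_uniform
  have hfin : ∀ v ω, P.final v ω = P.toLoop (P.searchRun v T SearchState.start ω) := fun v ω => by
    rw [P.final_eq_traj (hT v ω), P.toLoop_searchRun]
  simp only [hfin]
  rw [P.lintegral_searchRun v T SearchState.start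
      (fun x => φ ((P.toLoop x).best, (P.toLoop x).u)),
    P.lintegral_searchRun w T SearchState.start (fun x =>
      ENNReal.ofReal (Real.exp (B (P.toLoop x).u)) * φ ((P.toLoop x).best, (P.toLoop x).u))]
  -- Short runs are compared with `w` by composition; long runs are charged to the additive term,
  -- under `v` alone.
  set good : SearchState P.n → ℝ≥0∞ := fun x =>
    if SearchState.iterationBound d x.pos.size < x.count then 0
    else φ ((P.toLoop x).best, (P.toLoop x).u) with hgood
  set bad : SearchState P.n → ℝ≥0∞ := fun x =>
    if SearchState.iterationBound d x.pos.size < x.count then 1 else 0 with hbad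
  refine (chainValue_mono (I := fun _ => True) (φ := fun x => good x + bad x)
    (fun _ _ _ _ => trivial) (fun x _ => ?_) T trivial).trans ?_
  · simp only [hgood, hbad]
    split_ifs <;> simp [hφ]
  rw [chainValue_add]
  refine add_le_add ?_ ?_
  · have h1 := chainValue_composition (ψ := good) (halt := fun x => P.Halted (P.toLoop x))
      (next := SearchState.advance) (e := ENNReal.ofReal (Real.exp P.ε₀))
      (fun x o => P.acceptLaw_le hvw (P.toLoop x) o) SearchState.count
      (fun x o => SearchState.count_advance x o) T SearchState.start
    rw [show (SearchState.start : SearchState P.n).count = 0 from rfl, pow_zero, one_mul] at h1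
    refine h1.trans (chainValue_mono (I := fun _ => True) (fun _ _ _ _ => trivial)
      (fun x _ => ?_) T trivial)
    simp only [hgood]
    split_ifs with hc
    · simp
    · gcongr
      rw [← ENNReal.ofReal_pow (Real.exp_pos _).le, ← Real.exp_nat_mul]
      gcongr
      exact hB _ _ (not_lt.1 hc)
  · refine SearchState.chainValue_iterationBound_lt (fun x hx => P.halted_toLoop_of_lvl hx)
      (F := fun i => P.acceptProb v (P.u₀ + i * P.g)) ?_ (fun _ => measureReal_nonneg)
      (fun _ => measureReal_le_one) ?_ ?_ d T
    · intro i j hij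
      refine P.antitone_acceptProb v ?_
      have : (i : ℝ) ≤ j := by exact_mod_cast hij
      have := P.g_mem.1
      gcongr
    · intro x
      rw [sum_acceptLaw_some]
      simp only [toLoop]
      push_cast
      congr 2
      ring
    · intro x
      rw [acceptLaw_none]
      simp only [toLoop]
      push_cast
      congr 3
      ring

end TuningSetup

/-! ### The explicit privacy loss -/

theorem Nat.size_le_one_add_two_mul_log (N : ℕ) : (N.size : ℝ) ≤ 1 + 2 * Real.log (N + 1) := by
  rcases Nat.eq_zero_or_pos N.size with h | h
  · have : (0 : ℝ) ≤ Real.log (N + 1) := Real.log_nonneg (by simp)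
    rw [h]
    push_cast
    linarith
  · obtain ⟨s, hs⟩ := Nat.exists_eq_succ_of_ne_zero h.ne'
    have h1 : 2 ^ s ≤ N := Nat.lt_size.1 (by omega)
    have h2 : (2 : ℝ) ^ s ≤ N + 1 := by exact_mod_cast (by omega : 2 ^ s ≤ N + 1)
    have h3 := Real.log_le_log (by positivity) h2
    rw [Real.log_pow] at h3
    have h4 := Real.log_two_gt_d9
    rw [hs]
    push_cast
    nlinarith [(Nat.cast_nonneg s : (0 : ℝ) ≤ s)]

theorem exists_half_pow_le {η : ℝ} (h0 : 0 < η) (h1 : η < 1) :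
    ∃ d : ℕ, (1 / 2 : ℝ) ^ d ≤ η ∧ (d : ℝ) ≤ 1 + 2 * Real.log (1 / η) := by
  have hl2 := Real.log_two_gt_d9
  have hm : 0 ≤ Real.log (1 / η) := Real.log_nonneg (by rw [le_div_iff₀ h0]; linarith)
  refine ⟨⌈Real.log (1 / η) / Real.log 2⌉₊, ?_, ?_⟩
  · have h2 := Nat.le_ceil (Real.log (1 / η) / Real.log 2)
    rw [div_le_iff₀ (by linarith)] at h2
    rw [one_div, inv_pow]
    refine inv_le_of_inv_le₀ h0 ?_
    rw [← Real.log_le_log_iff (by positivity) (by positivity), Real.log_pow, ← one_div]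
    exact h2
  · have h2 := Nat.ceil_lt_add_one (div_nonneg hm (by linarith : 0 ≤ Real.log 2))
    have h3 : Real.log (1 / η) / Real.log 2 ≤ 2 * Real.log (1 / η) := by
      rw [div_le_iff₀ (by linarith)]
      nlinarith
    linarith

namespace TuningSetup

open scoped ENNReal

variable {X Y H Θ : Type*} [MeasurableSpace Θ] (P : TuningSetup X Y H Θ)

/-- Each factor of `iterationBound` is linear in `Λ`, which gives the power `4` and the constant
`1134 = 3 * 3 ^ 3 * 14`. -/
theorem mul_le_extraLoss {η : ℝ} (h0 : 0 < η) (h1 : η < 1) {d : ℕ}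
    (hd : (d : ℝ) ≤ 1 + 2 * Real.log (1 / η)) {N c : ℕ}
    (hc : c ≤ SearchState.iterationBound d N.size) :
    c * P.ε₀ ≤ P.extraLoss 1134 4 η (P.u₀ + N * P.g) := by
  have hε := P.ε₀_pos
  have hg := P.g_mem.1
  have hN : (P.u₀ + N * P.g - P.u₀) / P.g = N := by field_simp; ring
  unfold extraLoss
  rw [hN]
  have hℓ : (0 : ℝ) ≤ Real.log (N + 1) := Real.log_nonneg (by simp)
  have hm : 0 ≤ Real.log (1 / η) := Real.log_nonneg (by rw [le_div_iff₀ h0]; linarith)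
  have hlog : Real.log ((N + 1) / η) = Real.log (N + 1) + Real.log (1 / η) := by
    rw [div_eq_mul_one_div, Real.log_mul (by positivity) (by positivity)]
  rw [hlog]
  have hsz := Nat.size_le_one_add_two_mul_log N
  set Λ : ℝ := 1 + (Real.log (N + 1) + Real.log (1 / η)) with hΛ
  have hΛ1 : 1 ≤ Λ := by linarith
  have hc' : (c : ℝ) ≤ 3 * (N.size + 2) ^ 3 * (4 * (N.size + 2) + 1 + d) := by
    exact_mod_cast hc
  have hy : (N.size : ℝ) + 2 ≤ 3 * Λ := by linarith
  have hz : 4 * ((N.size : ℝ) + 2) + 1 + d ≤ 14 * Λ := by linarith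
  have hsq : 1 ≤ Real.sqrt (N + 1) := Real.one_le_sqrt.2 (by simp)
  gcongr
  calc (c : ℝ) ≤ 3 * (N.size + 2) ^ 3 * (4 * (N.size + 2) + 1 + d) := hc'
    _ ≤ 3 * (3 * Λ) ^ 3 * (14 * Λ) := by gcongr
    _ = 1134 * 1 * Λ ^ 4 := by ring
    _ ≤ _ := by gcongr

theorem extraLoss_mono {C : ℝ} (hC : 0 ≤ C) (c : ℕ) {η u u' : ℝ} (h0 : 0 < η) (h1 : η < 1)
    (hu : P.u₀ ≤ u) (huu : u ≤ u') : P.extraLoss C c η u ≤ P.extraLoss C c η u' := by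
  have hε := P.ε₀_pos
  have hg := P.g_mem.1
  have hN : 0 ≤ (u - P.u₀) / P.g := div_nonneg (by linarith) hg.le
  have hlog : 0 ≤ Real.log (((u - P.u₀) / P.g + 1) / η) :=
    Real.log_nonneg (by rw [le_div_iff₀ h0]; linarith)
  unfold extraLoss
  gcongr

theorem measurable_extraLoss (C : ℝ) (c : ℕ) (η : ℝ) : Measurable (P.extraLoss C c η) := by
  unfold extraLoss
  fun_prop

/-! ### Neighbouring training sets -/

theorem exists_part_eq {D D' : Multiset X} (h : Neighbouring D D') :
    ∃ i, ∀ j ≠ i, P.split.part D j = P.split.part D' j := by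
  obtain ⟨x, rfl | rfl⟩ := h
  · obtain ⟨i, hi⟩ := P.split.part_cons x D
    exact ⟨i, fun j hj => by rw [hi, Function.update_of_ne hj]⟩
  · obtain ⟨i, hi⟩ := P.split.part_cons x D'
    exact ⟨i, fun j hj => by rw [hi, Function.update_of_ne hj]⟩

theorem abs_util_sub_le {θ θ' : Fin P.n → Fin P.k → Θ} {i : Fin P.k}
    (h : ∀ s, ∀ j ≠ i, θ s j = θ' s j) (s : Fin P.n) :
    |P.util θ s - P.util θ' s| ≤ 1 / P.k := by
  have hk : (0 : ℝ) < P.k := by exact_mod_cast P.k_pos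
  unfold util
  rw [← mul_sub, ← Finset.sum_sub_distrib, Finset.sum_eq_single i (fun j _ hj => by
    rw [h s j hj, sub_self]) (by simp), abs_mul, abs_of_pos (by positivity)]
  refine mul_le_of_le_one_right (by positivity) (abs_le.2 ?_)
  have h1 := P.acc_mem (θ s i)
  have h2 := P.acc_mem (θ' s i)
  constructor <;> linarith [h1.1, h1.2, h2.1, h2.2]

/-- Runs on training sets that share all parts but one can be coupled so that only the runs on that
part differ. -/
theorem lintegral_runs_le {D D' : Multiset X} {i : Fin P.k}
    (hD : ∀ j ≠ i, P.split.part D j = P.split.part D' j)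
    {f g : (Fin P.n → Fin P.k → Θ) → ℝ≥0∞} (hf : Measurable f) (hg : Measurable g) {c : ℝ≥0∞}
    (h : ∀ θ θ', (∀ s, ∀ j ≠ i, θ s j = θ' s j) → f θ ≤ g θ' + c) :
    ∫⁻ θ, f θ ∂P.runs D ≤ ∫⁻ θ, g θ ∂P.runs D' + c := by
  set μ : Fin P.n → Fin P.k → Measure Θ := fun s j => P.train (P.split.part D j) (P.cand s)
  set ν : Fin P.n → Fin P.k → Measure Θ := fun s j => P.train (P.split.part D' j) (P.cand s)
  -- Two independent runs are drawn per cell. The first dataset reads `fst` everywhere; the second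
  -- reads `snd` on part `i` only, and elsewhere the two marginals coincide.
  set ρ : Measure (Fin P.n → Fin P.k → Θ × Θ) :=
    Measure.pi fun s => Measure.pi fun j => (μ s j).prod (ν s j)
  have h1 : MeasurePreserving (fun (r : Fin P.n → Fin P.k → Θ × Θ) s j => (r s j).1) ρ
      (P.runs D) :=
    measurePreserving_pi _ _ fun s => measurePreserving_pi _ _ fun j =>
      (measurePreserving_fst : MeasurePreserving Prod.fst ((μ s j).prod (ν s j)) (μ s j))
  have h2 : MeasurePreserving (fun (r : Fin P.n → Fin P.k → Θ × Θ) s j =>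
      (if j = i then Prod.snd else Prod.fst : Θ × Θ → Θ) (r s j)) ρ (P.runs D') := by
    refine measurePreserving_pi _ _ fun s => measurePreserving_pi _
      (fun j => (P.train (P.split.part D' j) (P.cand s) : Measure Θ))
      (f := fun j => (if j = i then Prod.snd else Prod.fst : Θ × Θ → Θ)) fun j => ?_
    split_ifs with hj
    · exact (measurePreserving_snd : MeasurePreserving Prod.snd ((μ s j).prod (ν s j)) (ν s j))
    · rw [← hD j hj]
      exact (measurePreserving_fst : MeasurePreserving Prod.fst ((μ s j).prod (ν s j)) (μ s j))
  rw [← h1.lintegral_comp hf, ← h2.lintegral_comp hg]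
  calc _ ≤ ∫⁻ r, (g (fun s j => (if j = i then Prod.snd else Prod.fst : Θ × Θ → Θ) (r s j)) + c)
        ∂ρ := lintegral_mono fun r => h _ _ fun s j hj => by simp [hj]
    _ = _ := by
      rw [lintegral_add_right _ measurable_const]
      simp

theorem measurable_final_util :
    Measurable fun r : (Fin P.n → Fin P.k → Θ) × (ℕ → P.Noise) =>
      ((P.final (P.util r.1) r.2).best, (P.final (P.util r.1) r.2).u) :=
  P.measurable_final.comp ((P.measurable_util.comp measurable_fst).prodMk measurable_snd)

theorem lintegral_searchLaw (D : Multiset X) {φ : Option (Fin P.n) × ℝ → ℝ≥0∞}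
    (hφ : Measurable φ) :
    ∫⁻ o, φ o ∂P.searchLaw D = ∫⁻ θ, ∫⁻ ω, φ ((P.final (P.util θ) ω).best,
      (P.final (P.util θ) ω).u) ∂(Measure.infinitePi fun _ : ℕ => P.noiseLaw) ∂P.runs D := by
  have hm := P.measurable_final_util
  rw [searchLaw, lintegral_map hφ hm]
  exact lintegral_prod _ (hφ.comp hm).aemeasurable

theorem measurable_lintegral_final {φ : Option (Fin P.n) × ℝ → ℝ≥0∞} (hφ : Measurable φ) :
    Measurable fun θ => ∫⁻ ω, φ ((P.final (P.util θ) ω).best, (P.final (P.util θ) ω).u)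
      ∂(Measure.infinitePi fun _ : ℕ => P.noiseLaw) := by
  have hm := P.measurable_final_util
  exact (hφ.comp hm).lintegral_prod_right'

/-- Privacy of the search, with a privacy loss that depends on the final accumulated utility. -/
theorem lintegral_searchLaw_le {η : ℝ} (h0 : 0 < η) (h1 : η < 1) {D D' : Multiset X}
    (hD : Neighbouring D D') {φ : Option (Fin P.n) × ℝ → ℝ≥0∞} (hφm : Measurable φ)
    (hφ : ∀ o, φ o ≤ 1) :
    ∫⁻ o, φ o ∂P.searchLaw D ≤
      ∫⁻ o, ENNReal.ofReal (Real.exp (P.extraLoss 1134 4 η o.2)) * φ o ∂P.searchLaw D' +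
        ENNReal.ofReal η := by
  obtain ⟨d, hdη, hd⟩ := exists_half_pow_le h0 h1
  obtain ⟨i, hi⟩ := P.exists_part_eq hD
  have hm : Measurable fun o : Option (Fin P.n) × ℝ =>
      ENNReal.ofReal (Real.exp (P.extraLoss 1134 4 η o.2)) * φ o :=
    (((P.measurable_extraLoss 1134 4 η).comp measurable_snd).exp.ennreal_ofReal).mul hφm
  rw [P.lintegral_searchLaw D hφm, P.lintegral_searchLaw D' hm]
  refine P.lintegral_runs_le hi (P.measurable_lintegral_final hφm)
    (P.measurable_lintegral_final hm) fun θ θ' h => ?_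
  refine (P.lintegral_final_le (P.abs_util_sub_le h)
    (fun N c hc => P.mul_le_extraLoss h0 h1 hd hc) hφ).trans ?_
  gcongr

theorem ae_le_searchLaw (D : Multiset X) : ∀ᵐ o ∂P.searchLaw D, P.u₀ ≤ o.2 := by
  have hm := P.measurable_final_util
  rw [searchLaw, ae_map_iff hm.aemeasurable (measurableSet_le measurable_const measurable_snd)]
  refine ae_of_all _ fun r => ?_
  obtain ⟨x, hx⟩ := P.exists_final_eq_toLoop (P.util r.1) r.2
  have := P.g_mem.1
  simp only [hx, toLoop]
  have : 0 ≤ x.pos * P.g := by positivity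
  linarith

theorem ae_le_fullLaw (D : Multiset X) : ∀ᵐ o ∂P.fullLaw D, P.u₀ ≤ o.1.2 := by
  have hs : MeasurableSet {o : (Option (Fin P.n) × ℝ) × Θ | P.u₀ ≤ o.1.2} :=
    measurableSet_le measurable_const (measurable_snd.comp measurable_fst)
  unfold fullLaw
  rw [Measure.ae_compProd_iff hs]
  filter_upwards [P.ae_le_searchLaw D] with o ho
  exact ae_of_all _ fun _ => ho

/-! ### Composition with the final training run -/

/-- Privacy of the output together with the final accumulated utility. -/
theorem isOutputDP_fullLaw {ε δ η : ℝ} (h0 : 0 < η) (h1 : η < 1) (hδ : 0 ≤ δ)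
    (hpt : ∀ h : Option H, IsDP (fun D => (P.privateTrain D h : Measure Θ)) ε δ) :
    IsOutputDP P.fullLaw (fun o => ε + P.extraLoss 1134 4 η o.1.2) (δ + η) := by
  intro D D' hD E hE
  set κ : Option (Fin P.n) × ℝ → ℝ≥0∞ := fun o => P.finalRun D' o (Prod.mk o ⁻¹' E)
  have hκ : Measurable κ := Kernel.measurable_kernel_prodMk_left hE
  -- Truncating at `1` keeps the search's additive error equal to `η`, without a factor `exp ε`;
  -- this is allowed because probabilities are at most `1`.
  set φ : Option (Fin P.n) × ℝ → ℝ≥0∞ := fun o => min 1 (ENNReal.ofReal (Real.exp ε) * κ o)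
  have hφm : Measurable φ := measurable_const.min (hκ.const_mul _)
  have hexp : Measurable fun o : (Option (Fin P.n) × ℝ) × Θ =>
      ENNReal.ofReal (Real.exp (ε + P.extraLoss 1134 4 η o.1.2)) :=
    (((P.measurable_extraLoss 1134 4 η).comp
      (measurable_snd.comp measurable_fst)).const_add ε).exp.ennreal_ofReal
  have hstep : ∀ o, P.finalRun D o (Prod.mk o ⁻¹' E) ≤ φ o + ENNReal.ofReal δ := by
    intro o
    have hle : P.finalRun D o (Prod.mk o ⁻¹' E) ≤
        ENNReal.ofReal (Real.exp ε) * κ o + ENNReal.ofReal δ :=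
      hpt (o.1.map P.cand) D D' hD _ (measurable_prodMk_left hE)
    rw [← min_add_add_right]
    exact le_min (prob_le_one.trans le_self_add) hle
  calc P.fullLaw D E = ∫⁻ o, P.finalRun D o (Prod.mk o ⁻¹' E) ∂P.searchLaw D :=
        Measure.compProd_apply hE
    _ ≤ ∫⁻ o, (φ o + ENNReal.ofReal δ) ∂P.searchLaw D := lintegral_mono hstep
    _ = ∫⁻ o, φ o ∂P.searchLaw D + ENNReal.ofReal δ := by
        rw [lintegral_add_right _ measurable_const]
        simp
    _ ≤ (∫⁻ o, ENNReal.ofReal (Real.exp (P.extraLoss 1134 4 η o.2)) * φ o ∂P.searchLaw D' +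
          ENNReal.ofReal η) + ENNReal.ofReal δ := by
        gcongr
        exact P.lintegral_searchLaw_le h0 h1 hD hφm fun o => min_le_left _ _
    _ ≤ (∫⁻ o in E, ENNReal.ofReal (Real.exp (ε + P.extraLoss 1134 4 η o.1.2)) ∂P.fullLaw D') +
          ENNReal.ofReal η + ENNReal.ofReal δ := by
        gcongr
        rw [← lintegral_indicator hE, fullLaw, Measure.lintegral_compProd (hexp.indicator hE)]
        refine lintegral_mono fun o => ?_
        have hind : ∀ b, E.indicator (fun o : (Option (Fin P.n) × ℝ) × Θ =>
            ENNReal.ofReal (Real.exp (ε + P.extraLoss 1134 4 η o.1.2))) (o, b) =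
            (Prod.mk o ⁻¹' E).indicator (fun _ =>
              ENNReal.ofReal (Real.exp (ε + P.extraLoss 1134 4 η o.2))) b := fun b => rfl
        simp only [hind]
        rw [lintegral_indicator_const (measurable_prodMk_left hE), Real.exp_add,
          ENNReal.ofReal_mul (Real.exp_pos _).le, mul_comm (ENNReal.ofReal (Real.exp ε)), mul_assoc]
        gcongr
        exact min_le_right _ _
    _ = _ := by rw [add_assoc, ← ENNReal.ofReal_add h0.le hδ, add_comm η]

/-- Privacy of the output when the final accumulated utility is bounded. -/
theorem isDP_outputLaw {ε δ η U : ℝ} (h0 : 0 < η) (h1 : η < 1) (hδ : 0 ≤ δ)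
    (hpt : ∀ h : Option H, IsDP (fun D => (P.privateTrain D h : Measure Θ)) ε δ)
    (hU : ∀ D, ∀ᵐ o ∂P.fullLaw D, o.1.2 ≤ U) :
    IsDP P.outputLaw (ε + P.extraLoss 1134 4 η U) (δ + η) := by
  intro D D' hD E hE
  have hm : Measurable fun o : (Option (Fin P.n) × ℝ) × Θ => (o.1.1, o.2) := by fun_prop
  unfold outputLaw
  rw [Measure.map_apply hm hE, Measure.map_apply hm hE]
  refine (P.isOutputDP_fullLaw h0 h1 hδ hpt D D' hD _ (hm hE)).trans ?_
  gcongr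
  rw [← setLIntegral_const]
  refine lintegral_mono_ae (ae_restrict_of_ae ?_)
  -- The loss is integrated under `D'`. The lower bound `u₀` is needed because the loss is shown to
  -- be monotone only from there on.
  filter_upwards [hU D', P.ae_le_fullLaw D'] with o ho ho'
  gcongr
  exact P.extraLoss_mono (by norm_num) 4 h0 h1 ho' ho

end TuningSetup

end

theorem mainTheorem1 :
    ∃ C : ℝ, 0 < C ∧ ∃ c : ℕ,
      ∀ (X Y H Θ : Type*) [MeasurableSpace Θ] (P : TuningSetup X Y H Θ) (ε δ δ' : ℝ),
        0 < ε → δ ∈ Set.Ioo (0 : ℝ) 1 → δ' ∈ Set.Ioo (0 : ℝ) 1 →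
        (∀ h : Option H, IsDP (fun D => (P.privateTrain D h : Measure Θ)) ε δ) →
        IsOutputDP P.fullLaw (fun o => ε + P.extraLoss C c δ' o.1.2) (δ + δ') ∧
        ∀ U : ℝ, (∀ D, ∀ᵐ o ∂(P.fullLaw D), o.1.2 ≤ U) →
          IsDP P.outputLaw (ε + P.extraLoss C c δ' U) (δ + δ') :=
  ⟨1134, by norm_num, 4, fun _ _ _ _ _ P _ _ _ _ hδ hδ' hpt =>
    ⟨P.isOutputDP_fullLaw hδ'.1 hδ'.2 hδ.1.le hpt,
      fun _ hU => P.isDP_outputLaw hδ'.1 hδ'.2 hδ.1.le hpt hU⟩⟩
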